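/- **Model.** A quantum circuit is a sequence of layers; a layer consists of gates on disjoint sets of qubits, a gate is a single-qubit unitary with any number of controls, and the depth is the number of layers. A gate is *elementary* if it has at most two controls. A circuit is run on the all-zero state and all qubits are measured at the end. **Process.** Let $n,l_x,l_\tau\ge 1$. A process $\{X(t)\}$ on a probability space is given in holding-time representation with $n$ pieces by random pairs $(X_j,\tau_j)$, $1\le j\le n$, of arbitrary joint law, with $X(t)=X_j$ for $T_{j-1}\le t<T_j$, where $T_0=0$ and $T_j=\tau_1+\dots+\tau_j$, almost surely. Here $\tau_j\ge1$ is an integer with $l_\tau$ binary digits, and $X_j=\sum_{i=1}^{l_x} b_{ji}w_i$ is encoded by $l_x$ bits $b_{ji}$ with fixed real weights $w_i$ (unsigned, two's complement or fixed-point numbers). Put $T=T_n$ and $I(X,T)=\int_0^T X(t)\,dt$. A circuit of depth $\mathcal P$ on $n(l_x+l_\tau)$ data and time qubits and at most $n(l_x+l_\tau)$ index and work qubits *prepares* the process if measuring the data and time registers of its output yields exactly the joint law of the encodings of $(X_j,\tau_j)_{j\le n}$. **Fourier approximation.** Let $a\in\mathbb R$, $P>0$, $L\ge0$, and let $f:\mathbb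 R\to\mathbb R$ be integrable on $[a,a+P]$. Put $c_l=\frac1P\int_a^{a+P}f(x)e^{-2\pi i lx/P}\,dx$ and $f_{P,L}(x)=\sum_{l=-L}^{L}c_l e^{2\pi i l x/P}$. Let $K$ be such that $l\,|c_l|\le KP$ for $1\le l\le L$. **Theorem.** There is an absolute constant $C>0$ such that for all data as above, fixed weights $w_i$ and every $\epsilon>0$ there are circuits $M_s$, indexed by $s=(l,\text{cosine or sine})$ with $|l|\le L$, consisting only of rotations of one additional target qubit that are controlled by at most two qubits, and an estimation procedure, with the following properties. Neither the $M_s$ nor the procedure depends on the process or on the circuit that prepares it. Each run of the procedure is a sequence of layers of elementary gates and of uses of the evaluation circuits $A_s$ = (preparation, then $M_s$) and of their inverses, with further ancilla qubits, and ends with a measurement; the final estimate is a function of the outcomes of all runs. For every process $X$ and every circuit of depth $\mathcal P$ that prepares it: 1. $I(X,T)=\sum_{j=1}^n X_j\tau_j$ almost surely. 2. Every evaluation circuit $A_s$ has depth at most $C(\mathcal P+n l_xl_\tau)$, and its target qubit is measured as $1$ with probability $\frac12\bigl(1+\mathbb E[\cos(\tfrac{2\pi l}{P}I(X,T))]\bigr)$,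 respectively $\frac12\bigl(1+\mathbb E[\sin(\tfrac{2\pi l}{P}I(X,T))]\bigr)$. 3. The total time, i.e. the number of layers executed in all runs together, is at most $C\,K\,\frac{LP}{\epsilon}(\mathcal P+n l_xl_\tau)$. 4. With probability at least $2/3$ the estimate is within $\epsilon$ of $\mathbb E[f_{P,L}(I(X,T))]$; also with probability at least $2/3$ it is within $\epsilon+\mathbb E\,|f(I(X,T))-f_{P,L}(I(X,T))|$ of $\mathbb E[f(I(X,T))]$. Moreover, if $f:\mathbb R\to\mathbb R$ has total variation at most $KP$ on $[a,a+P]$ with $K\ge0$ (for instance, if $f$ is Lipschitz with constant $K$), then $f$ is integrable on $[a,a+P]$ and $l\,|c_l|\le KP$ for all $l\ge1$. So for such $f$ the time is $O\bigl(\frac{LP}{\epsilon}(\mathcal P+nl_xl_\tau)\bigr)$ with a constant that depends only on $K$. -/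

import Mathlib

noncomputable section

namespace QCTSP

/-! Circuits over a type `ι` of qubits (wires). A pure state is its vector of amplitudes
`(ι → Bool) → ℂ` in the computational basis. -/

/-- A single-qubit unitary on `target`, controlled on all qubits of `controls` being `1`. -/
structure Gate (ι : Type*) [DecidableEq ι] where
  target : ι
  controls : Finset ι
  target_notMem : target ∉ controls
  mat : Matrix.unitaryGroup Bool ℂ

namespace Gate

variable {ι κ : Type*} [DecidableEq ι] [DecidableEq κ]

/-- The qubits on which the gate acts. -/
def support (g : Gate ι) : Finset ι := insert g.target g.controls

/-- The action of the gate on amplitude vectors. -/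
def apply (g : Gate ι) (ψ : (ι → Bool) → ℂ) : (ι → Bool) → ℂ := fun x =>
  if ∀ c ∈ g.controls, x c = true then
    ∑ b : Bool, (g.mat : Matrix Bool Bool ℂ) (x g.target) b * ψ (Function.update x g.target b)
  else ψ x

/-- The inverse gate. -/
def adjoint (g : Gate ι) : Gate ι where
  target := g.target
  controls := g.controls
  target_notMem := g.target_notMem
  mat := star g.mat

/-- The same gate inside a larger set of qubits. -/
def map (e : ι ↪ κ) (g : Gate ι) : Gate κ where
  target := e g.target
  controls := g.controls.map e
  target_notMem := by simpa using g.target_notMem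
  mat := g.mat

/-- At most two controls: the gates which the evaluation algorithm itself may use. -/
def Elementary (g : Gate ι) : Prop := g.controls.card ≤ 2

theorem support_adjoint (g : Gate ι) : g.adjoint.support = g.support := rfl

theorem support_map (e : ι ↪ κ) (g : Gate ι) : (g.map e).support = g.support.map e := by
  simp [support, map, Finset.map_insert]

end Gate

/-- One time step of a circuit: gates that act on pairwise disjoint sets of qubits. -/
structure Layer (ι : Type*) [DecidableEq ι] where
  gates : List (Gate ι)
  disjoint : gates.Pairwise fun g h => Disjoint g.support h.support

namespace Layer

variable {ι κ : Type*} [DecidableEq ι] [DecidableEq κ]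

def apply (ly : Layer ι) (ψ : (ι → Bool) → ℂ) : (ι → Bool) → ℂ :=
  ly.gates.foldl (fun φ g => g.apply φ) ψ

def adjoint (ly : Layer ι) : Layer ι where
  gates := ly.gates.map Gate.adjoint
  disjoint := List.pairwise_map.2 ly.disjoint

def map (e : ι ↪ κ) (ly : Layer ι) : Layer κ where
  gates := ly.gates.map (Gate.map e)
  disjoint := List.pairwise_map.2 <| ly.disjoint.imp fun h => by
    rw [Gate.support_map, Gate.support_map]
    exact (Finset.disjoint_map e).2 h

def Elementary (ly : Layer ι) : Prop := ∀ g ∈ ly.gates, g.Elementary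

end Layer

open Classical in
/-- The state in which all qubits are `0`. -/
def zeroState (ι : Type*) : (ι → Bool) → ℂ := fun x => if ∀ i, x i = false then 1 else 0

/-- A circuit is the list of its layers, in order of execution. -/
abbrev Circuit (ι : Type*) [DecidableEq ι] := List (Layer ι)

namespace Circuit

variable {ι κ : Type*} [DecidableEq ι] [DecidableEq κ]

/-- Circuit depth: the number of layers. -/
def depth (c : Circuit ι) : ℕ := List.length c

def apply (c : Circuit ι) (ψ : (ι → Bool) → ℂ) : (ι → Bool) → ℂ :=
  List.foldl (fun φ ly => ly.apply φ) ψ c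

/-- The inverse circuit: the adjoint layers in reverse order. -/
def adjoint (c : Circuit ι) : Circuit ι := (List.map Layer.adjoint c).reverse

/-- The same circuit inside a larger set of qubits. -/
def onWires (e : ι ↪ κ) (c : Circuit ι) : Circuit κ := List.map (Layer.map e) c

/-- Probability of reading the bit string `x` when all qubits are measured after the circuit has
been run on the all-zero state. -/
def outcomeProb (c : Circuit ι) (x : ι → Bool) : ℝ :=
  ‖c.apply (zeroState ι) x‖ ^ 2

end Circuit

/-- The rotation by the angle `θ` of the real plane spanned by `|0⟩` and `|1⟩`. -/
def rotation (θ : ℝ) : Matrix Bool Bool ℂ := Matrix.of fun r s =>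
  match r, s with
  | false, false => (Real.cos θ : ℂ)
  | false, true => -(Real.sin θ : ℂ)
  | true, false => (Real.sin θ : ℂ)
  | true, true => (Real.cos θ : ℂ)

/-! Processes with piecewise constant paths and their holding-time representation. -/

/-- The number encoded by a bit string with weights `wt`: weights `2 ^ i` give unsigned integers, a
negative last weight gives two's complement, other scalings give fixed-point numbers. -/
def bitValue {l : ℕ} (wt : Fin l → ℝ) (b : Fin l → Bool) : ℝ := ∑ i, if b i then wt i else 0

/-- The natural number with binary digits `b`, least significant digit first. -/
def bitNat {l : ℕ} (b : Fin l → Bool) : ℕ := ∑ i : Fin l, if b i then 2 ^ (i : ℕ) else 0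

/-- The end `T_m` of the `m`-th piece, for holding times `τ`; `T_0 = 0`. -/
def cumTime {n : ℕ} (τ : Fin n → ℕ) (m : ℕ) : ℕ := ∑ j : Fin n, if (j : ℕ) < m then τ j else 0

/-- A holding-time representation of the continuous time process `X` with `n` pieces: random
registers, `lx` bits for the value and `lτ` bits for the holding time of each piece, such that the
holding times are positive and `X` equals the value of the piece throughout the piece. The joint law
of the pairs is arbitrary: each may depend on all the earlier ones. -/
structure HoldingTimeRep {Ω : Type*} [MeasurableSpace Ω] (μ : MeasureTheory.Measure Ω)
    (X : ℝ → Ω → ℝ) (n lx lτ : ℕ) (wt : Fin lx → ℝ) where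
  valueBits : Ω → Fin n → Fin lx → Bool
  holdBits : Ω → Fin n → Fin lτ → Bool
  measurable_valueBits : Measurable valueBits
  measurable_holdBits : Measurable holdBits
  hold_pos : ∀ᵐ ω ∂μ, ∀ j, 0 < bitNat (holdBits ω j)
  path_eq : ∀ᵐ ω ∂μ, ∀ (j : Fin n) (t : ℝ),
    (cumTime (fun i => bitNat (holdBits ω i)) j : ℝ) ≤ t →
    t < (cumTime (fun i => bitNat (holdBits ω i)) (j + 1) : ℝ) →
      X t ω = bitValue wt (valueBits ω j)

namespace HoldingTimeRep

variable {Ω : Type*} [MeasurableSpace Ω] {μ : MeasureTheory.Measure Ω} {X : ℝ → Ω → ℝ}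
  {n lx lτ : ℕ} {wt : Fin lx → ℝ}

/-- The value `X_j` of the `j`-th piece. -/
def value (R : HoldingTimeRep μ X n lx lτ wt) (j : Fin n) (ω : Ω) : ℝ :=
  bitValue wt (R.valueBits ω j)

/-- The holding time `τ_j` of the `j`-th piece. -/
def hold (R : HoldingTimeRep μ X n lx lτ wt) (j : Fin n) (ω : Ω) : ℕ := bitNat (R.holdBits ω j)

/-- The end `T = τ_1 + ⋯ + τ_n` of the last piece. -/
def endTime (R : HoldingTimeRep μ X n lx lτ wt) (ω : Ω) : ℕ := ∑ j, R.hold j ω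

/-- `I(X, T) = ∫_0^T X(t) dt`. -/
def pathIntegral (R : HoldingTimeRep μ X n lx lτ wt) (ω : Ω) : ℝ :=
  ∫ t in (0 : ℝ)..(R.endTime ω : ℝ), X t ω

end HoldingTimeRep

/-- The qubits of a preparation circuit: data register, time register, and `w` further qubits (index
register and work space). -/
abbrev Wire (n lx lτ w : ℕ) := (Fin n × Fin lx) ⊕ ((Fin n × Fin lτ) ⊕ Fin w)

/-- `prep` maps the zero state to a state whose data and time registers carry the law of the
process: `∑ p(k, t) |k, x(k), t⟩` with `|p(k, t)|²` the probability of the path. -/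
def Prepares {Ω : Type*} [MeasurableSpace Ω] {μ : MeasureTheory.Measure Ω} {X : ℝ → Ω → ℝ}
    {n lx lτ w : ℕ} {wt : Fin lx → ℝ} (prep : Circuit (Wire n lx lτ w))
    (R : HoldingTimeRep μ X n lx lτ wt) : Prop :=
  ∀ (xb : Fin n → Fin lx → Bool) (tb : Fin n → Fin lτ → Bool),
    ∑ wb : Fin w → Bool, prep.outcomeProb
        (Sum.elim (fun p => xb p.1 p.2) (Sum.elim (fun p => tb p.1 p.2) wb)) =
      μ.real {ω | R.valueBits ω = xb ∧ R.holdBits ω = tb}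

/-! The Fourier approximation. -/

/-- The `l`-th Fourier coefficient of the `P`-periodic function that agrees with `f` on the window
`(a, a + P]`. -/
def coeff (f : ℝ → ℝ) (a : ℝ) {P : ℝ} (hP : 0 < P) (l : ℤ) : ℂ :=
  fourierCoeffOn (lt_add_of_pos_right a hP) (fun x => (f x : ℂ)) l

/-- `f_{P,L}(x) = ∑_{l=-L}^{L} c_l exp(2π i l x / P)`; the sum is real since `f` is. -/
def fourierApprox (f : ℝ → ℝ) (a : ℝ) {P : ℝ} (hP : 0 < P) (L : ℕ) (x : ℝ) : ℝ :=
  (∑ l ∈ Finset.Icc (-(L : ℤ)) L,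
    coeff f a hP l * Complex.exp (2 * Real.pi * Complex.I * l * x / P)).re

/-- The two expectations that occur in each Fourier term. -/
inductive Part
  | cosine
  | sine

/-- `cos y` or `sin y`. -/
def Part.eval : Part → ℝ → ℝ
  | .cosine => Real.cos
  | .sine => Real.sin

/-- A frequency `l` with `|l| ≤ L`, together with the choice of cosine or sine. -/
structure Term (L : ℕ) where
  freq : ℤ
  freq_le : |freq| ≤ (L : ℤ)
  part : Part

/-! Evaluation circuits and estimation procedures. -/

/-- All gates are rotations of the additional target qubit controlled by at most two qubits. -/
def IsRotationCircuit {ι : Type*} [DecidableEq ι] (c : Circuit (ι ⊕ Unit)) : Prop :=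
  ∀ ly ∈ c, ∀ g ∈ ly.gates, g.target = Sum.inr () ∧ g.Elementary ∧
    ∃ θ : ℝ, (g.mat : Matrix Bool Bool ℂ) = rotation θ

/-- The preparation followed by `m`, on the preparation qubits and one target qubit. -/
def evalCircuit {ι : Type*} [DecidableEq ι] (prep : Circuit ι) (m : Circuit (ι ⊕ Unit)) :
    Circuit (ι ⊕ Unit) :=
  prep.onWires Function.Embedding.inl ++ m

/-- Probability of reading `1` on the target qubit. -/
def targetProb {ι : Type*} [Fintype ι] [DecidableEq ι] (c : Circuit (ι ⊕ Unit)) : ℝ :=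
  ∑ x : ι ⊕ Unit → Bool, if x (Sum.inr ()) then c.outcomeProb x else 0

/-- One step of an estimation procedure: a layer of elementary gates, or a call of one of the
circuits indexed by `S`, or of its inverse. -/
inductive Step (S ι : Type*) [DecidableEq ι]
  | layer (ly : Layer ι) (h : ly.Elementary)
  | call (s : S)
  | callInv (s : S)

/-- The layers that a step stands for, when `A s` is the circuit with index `s`. -/
def Step.expand {S ι κ : Type*} [DecidableEq ι] [DecidableEq κ] (e : ι ↪ κ) (A : S → Circuit ι) :
    Step S κ → Circuit κ
  | .layer ly _ => [ly]
  | .call s => (A s).onWires e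
  | .callInv s => ((A s).onWires e).adjoint

/-- An estimation procedure that uses circuits indexed by `S` on the qubits `ι` as subroutines. Each
run starts in the zero state on `ι` and `ancilla` further qubits, executes its steps, and ends with
a measurement of all qubits; the estimate is a function of the outcomes of the runs. -/
structure Procedure (S ι : Type*) [DecidableEq ι] where
  ancilla : ℕ
  numRuns : ℕ
  run : Fin numRuns → List (Step S (ι ⊕ Fin ancilla))
  estimate : (Fin numRuns → ι ⊕ Fin ancilla → Bool) → ℝ

namespace Procedure

variable {S ι : Type*} [DecidableEq ι]

/-- The circuit executed in run `r`. -/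
def circuit (p : Procedure S ι) (A : S → Circuit ι) (r : Fin p.numRuns) :
    Circuit (ι ⊕ Fin p.ancilla) :=
  (p.run r).flatMap (Step.expand Function.Embedding.inl A)

/-- Running time: the number of layers executed in all the runs together. -/
def time (p : Procedure S ι) (A : S → Circuit ι) : ℕ := ∑ r, (p.circuit A r).depth

/-- Probability that the estimate is within `ε` of `v`; the runs are independent. -/
def probWithin [Fintype ι] (p : Procedure S ι) (A : S → Circuit ι) (v ε : ℝ) : ℝ :=
  ∑ o : Fin p.numRuns → ι ⊕ Fin p.ancilla → Bool,
    if |p.estimate o - v| ≤ ε then ∏ r, (p.circuit A r).outcomeProb (o r) else 0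

end Procedure

end QCTSP

end

noncomputable section

/-! The evaluation circuit rotates the target qubit once for each pair of a value digit and a
holding-time digit of the same piece, controlled on both digits. Rotations in one plane add their
angles, and almost surely `I(X,T) = ∑ X_j τ_j`, which is bilinear in the digits. So the total angle
is a base angle plus half of `2πl I/P`, and its squared sine is `(1 + cos)/2` or `(1 + sin)/2`
(`totalAngle_evalAngles`, `targetProb_evalCircuit`).

Such a probability `p` is estimated by amplitude amplification without a quantum Fourier transform.
A flag qubit is first made `1` with probability `sin²(φ/2)`, where `cos φ = 4/5 - 3p/10`; after `k`
amplification steps this becomes `sin²((2k+1)φ/2)` (`sum_amplify`). Observing the multiples `3^j`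
and `3^j + 2` of `φ` for all `j < N` determines `φ` up to `O(3^(-N))` (`abs_sub_le_of_cos_close`).
Level `j` is run `2^(N-j)` times, so the cheap levels are the reliable ones. A first failure at
level `j` causes an error `O(3^(-j))` but has probability `O(4^(-(N-j)))`, so the expected error is
`O(3^(-N))` (`expect_phaseEstimate_le`). The cost is proportional to `∑ 2^(N-j) 3^j = 2(3^N - 2^N)`.
Hence precision `δ` costs `O(1/δ)`, with no logarithm.

It remains to distribute the precision over the frequencies. Frequency `l` enters the real Fourier
sum with weights at most `2KP/l`. With `3^(N_l)` of order `KP√L/(ε√l)`, both the weighted error and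
the cost are multiples of `∑ 1/√l ≤ 2√L`: the expected error is at most `ε/3`, and the cost is
`O(KLP/ε)` times the depth. Markov's inequality then gives probability `2/3`.

The bound on `l |c_l|` by the total variation holds because the exponential has mean zero on each of
its `l` periods, so a constant may be subtracted from `f` on each of them (`mul_norm_coeff_le`). -/

namespace QCTSP

/-! ### Unitarity and composition of gates, layers and circuits. -/

namespace Gate

variable {ι : Type*} [DecidableEq ι]

/-- The entries of the matrix of the gate. -/
def entry (g : Gate ι) (a b : Bool) : ℂ := (g.mat : Matrix Bool Bool ℂ) a b

theorem apply_eq (g : Gate ι) (ψ : (ι → Bool) → ℂ) (x : ι → Bool) :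
    g.apply ψ x = if ∀ c ∈ g.controls, x c = true then
      ∑ b : Bool, g.entry (x g.target) b * ψ (Function.update x g.target b) else ψ x := rfl

theorem entry_adjoint (g : Gate ι) (a b : Bool) : g.adjoint.entry a b = star (g.entry b a) := rfl

theorem sum_star_entry_mul_entry (g : Gate ι) (a c : Bool) :
    ∑ b, star (g.entry b a) * g.entry b c = if a = c then 1 else 0 := by
  have h := Unitary.star_mul_self_of_mem g.mat.2
  have h := congrFun (congrFun h a) c
  rw [Matrix.mul_apply, Matrix.one_apply] at h
  exact h

theorem forall_controls_update (g : Gate ι) (x : ι → Bool) (b : Bool) :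
    (∀ c ∈ g.controls, Function.update x g.target b c = true) ↔
      ∀ c ∈ g.controls, x c = true :=
  forall₂_congr fun c hc => by
    rw [Function.update_of_ne]
    rintro rfl
    exact g.target_notMem hc

theorem apply_apply_adjoint_cancel (g : Gate ι) (ψ : (ι → Bool) → ℂ) :
    g.adjoint.apply (g.apply ψ) = ψ := by
  funext x
  have hc := g.forall_controls_update x
  simp only [apply_eq, entry_adjoint, show g.adjoint.controls = g.controls from rfl,
    show g.adjoint.target = g.target from rfl, hc]
  split_ifs with h
  · have h1 := g.sum_star_entry_mul_entry (x g.target) true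
    have h2 := g.sum_star_entry_mul_entry (x g.target) false
    simp only [Fintype.sum_bool] at h1 h2
    simp only [Fintype.sum_bool, Function.update_self, Function.update_idem]
    have : ψ x = (if x g.target = true then 1 else 0) * ψ (Function.update x g.target true)
        + (if x g.target = false then 1 else 0) * ψ (Function.update x g.target false) := by
      cases hx : x g.target <;> simp [← hx]
    rw [this, ← h1, ← h2]
    ring
  · rfl

theorem adjoint_adjoint (g : Gate ι) : g.adjoint.adjoint = g := by
  simp [adjoint]

theorem isLinearMap_apply (g : Gate ι) : IsLinearMap ℂ g.apply where
  map_add φ ψ := by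
    funext x
    simp only [apply, Pi.add_apply]
    split_ifs
    · simp [mul_add, Finset.sum_add_distrib]
    · rfl
  map_smul a φ := by
    funext x
    simp only [apply, Pi.smul_apply, smul_eq_mul]
    split_ifs
    · simp only [Fintype.sum_bool]; ring
    · rfl

theorem apply_comm {g h : Gate ι} (hd : Disjoint g.support h.support) (ψ : (ι → Bool) → ℂ) :
    g.apply (h.apply ψ) = h.apply (g.apply ψ) := by
  rw [Finset.disjoint_left] at hd
  have hgh : g.target ≠ h.target := fun e =>
    hd (Finset.mem_insert_self _ _) (e ▸ Finset.mem_insert_self _ _)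
  funext x
  have hc : ∀ b, (∀ c ∈ h.controls, Function.update x g.target b c = true) ↔
      ∀ c ∈ h.controls, x c = true := fun b =>
    forall₂_congr fun c hc => by
      rw [Function.update_of_ne]
      rintro rfl
      exact hd (Finset.mem_insert_self _ _) (Finset.mem_insert_of_mem hc)
  have hc' : ∀ b, (∀ c ∈ g.controls, Function.update x h.target b c = true) ↔
      ∀ c ∈ g.controls, x c = true := fun b =>
    forall₂_congr fun c hc => by
      rw [Function.update_of_ne]
      rintro rfl
      exact hd (Finset.mem_insert_of_mem hc) (Finset.mem_insert_self _ _)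
  simp only [apply, hc, hc']
  split_ifs
  · simp only [Fintype.sum_bool, Function.update_of_ne hgh, Function.update_of_ne hgh.symm,
      Function.update_comm hgh]
    ring
  all_goals rfl

variable [Fintype ι]

theorem dotProduct_apply (g : Gate ι) (φ ψ : (ι → Bool) → ℂ) :
    star φ ⬝ᵥ g.apply ψ = star (g.adjoint.apply φ) ⬝ᵥ ψ := by
  -- Exchanging the summed bit with the bit of `x` at the target is an involution of the pairs `(x,
  -- b)`; it moves the matrix entry from `ψ` to `φ`.
  have key : ∀ F : (ι → Bool) → Bool → ℂ,
      ∑ x, ∑ b, F x b = ∑ x, ∑ b, F (Function.update x g.target b) (x g.target) := by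
    intro F
    rw [← Fintype.sum_prod_type', ← Fintype.sum_prod_type']
    refine Fintype.sum_bijective
      (fun p : (ι → Bool) × Bool => (Function.update p.1 g.target p.2, p.1 g.target)) ?_ _ _ ?_
    · refine Function.Involutive.bijective fun p => ?_
      simp
    · intro p
      simp
  have hc := g.forall_controls_update
  have := key fun x b => if ∀ c ∈ g.controls, x c = true then
    star (φ x) * (g.entry (x g.target) b * ψ (Function.update x g.target b)) else 0
  simp only [hc, Function.update_self, Function.update_idem, Function.update_eq_self] at this
  simp only [dotProduct, apply_eq, entry_adjoint, Pi.star_apply,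
    show g.adjoint.controls = g.controls from rfl, show g.adjoint.target = g.target from rfl]
  have h1 : ∀ x, star (φ x) * (if ∀ c ∈ g.controls, x c = true then
      ∑ b : Bool, g.entry (x g.target) b * ψ (Function.update x g.target b)
      else ψ x) = (∑ b, if ∀ c ∈ g.controls, x c = true then
    star (φ x) * (g.entry (x g.target) b * ψ (Function.update x g.target b))
    else 0) + if ∀ c ∈ g.controls, x c = true then 0 else star (φ x) * ψ x := by
    intro x
    split_ifs
    · simp [mul_add]
    · simp
  refine Eq.trans (Finset.sum_congr rfl fun x _ => by convert h1 x) ?_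
  rw [Finset.sum_add_distrib, this, ← Finset.sum_add_distrib]
  refine Finset.sum_congr rfl fun x _ => ?_
  split_ifs
  · simp only [Fintype.sum_bool, star_add, star_mul', star_star]
    ring
  · simp

theorem dotProduct_apply_apply (g : Gate ι) (φ ψ : (ι → Bool) → ℂ) :
    star (g.apply φ) ⬝ᵥ g.apply ψ = star φ ⬝ᵥ ψ := by
  rw [dotProduct_apply, apply_apply_adjoint_cancel]

end Gate

namespace Layer

variable {ι : Type*} [DecidableEq ι]

/-- The layer that consists of one gate. -/
def single (g : Gate ι) : Layer ι := ⟨[g], List.pairwise_singleton _ _⟩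

/-- The adjoint layer keeps the order of the gates. The adjoint of the first gate therefore has to
pass all later gates before it cancels, which disjointness of the supports permits. -/
theorem adjoint_apply_apply (ly : Layer ι) (ψ : (ι → Bool) → ℂ) :
    ly.adjoint.apply (ly.apply ψ) = ψ := by
  obtain ⟨gs, hgs⟩ := ly
  simp only [apply, adjoint]
  revert hgs
  induction gs generalizing ψ with
  | nil => exact fun _ => rfl
  | cons g gs ih =>
    intro hgs
    rw [List.pairwise_cons] at hgs
    have comm : ∀ (hs : List (Gate ι)), (∀ h ∈ hs, Disjoint g.support h.support) → ∀ φ,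
        g.adjoint.apply (hs.foldl (fun φ h => h.apply φ) φ) =
          hs.foldl (fun φ h => h.apply φ) (g.adjoint.apply φ) := by
      intro hs
      induction hs with
      | nil => intros; rfl
      | cons h hs ih' =>
        intro hh φ
        simp only [List.foldl_cons]
        rw [ih' (fun k hk => hh k (List.mem_cons_of_mem _ hk)),
          Gate.apply_comm (by rw [Gate.support_adjoint]; exact hh h List.mem_cons_self)]
    simp only [List.foldl_cons, List.map_cons]
    rw [comm gs hgs.1, Gate.apply_apply_adjoint_cancel]
    exact ih ψ hgs.2

theorem adjoint_adjoint (ly : Layer ι) : ly.adjoint.adjoint = ly := by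
  obtain ⟨gs, hgs⟩ := ly
  simp only [adjoint, List.map_map, mk.injEq]
  exact (List.map_congr_left fun g _ => Gate.adjoint_adjoint g).trans (List.map_id _)

theorem isLinearMap_apply (ly : Layer ι) : IsLinearMap ℂ ly.apply := by
  obtain ⟨gs, hgs⟩ := ly
  unfold apply
  simp only
  clear hgs
  induction gs with
  | nil => exact ⟨fun _ _ => rfl, fun _ _ => rfl⟩
  | cons g gs ih =>
    exact ⟨fun φ ψ => by simp only [List.foldl_cons, g.isLinearMap_apply.map_add, ih.map_add],
      fun a φ => by simp only [List.foldl_cons, g.isLinearMap_apply.map_smul, ih.map_smul]⟩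

theorem dotProduct_apply_apply [Fintype ι] (ly : Layer ι) (φ ψ : (ι → Bool) → ℂ) :
    star (ly.apply φ) ⬝ᵥ ly.apply ψ = star φ ⬝ᵥ ψ := by
  obtain ⟨gs, hgs⟩ := ly
  unfold apply
  simp only
  clear hgs
  induction gs generalizing φ ψ with
  | nil => rfl
  | cons g gs ih => simp only [List.foldl_cons]; rw [ih, Gate.dotProduct_apply_apply]

end Layer

namespace Circuit

variable {ι : Type*} [DecidableEq ι]

theorem apply_append (c d : Circuit ι) (ψ : (ι → Bool) → ℂ) :
    apply (c ++ d) ψ = d.apply (c.apply ψ) := List.foldl_append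

theorem apply_cons (ly : Layer ι) (c : Circuit ι) (ψ : (ι → Bool) → ℂ) :
    apply (ly :: c) ψ = c.apply (ly.apply ψ) := rfl

theorem adjoint_append (c d : Circuit ι) : adjoint (c ++ d) = d.adjoint ++ c.adjoint := by
  simp [adjoint]

theorem adjoint_adjoint (c : Circuit ι) : c.adjoint.adjoint = c := by
  simp only [adjoint, List.map_reverse, List.reverse_reverse, List.map_map]
  exact (List.map_congr_left fun g _ => Layer.adjoint_adjoint g).trans (List.map_id _)

theorem adjoint_apply_apply (c : Circuit ι) (ψ : (ι → Bool) → ℂ) :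
    c.adjoint.apply (c.apply ψ) = ψ := by
  induction c generalizing ψ with
  | nil => rfl
  | cons ly c ih =>
    rw [show (ly :: c : Circuit ι) = [ly] ++ c from rfl, adjoint_append, apply_append,
      apply_append, ih]
    exact ly.adjoint_apply_apply ψ

theorem apply_adjoint_apply (c : Circuit ι) (ψ : (ι → Bool) → ℂ) :
    c.apply (c.adjoint.apply ψ) = ψ := by
  have := adjoint_apply_apply c.adjoint ψ
  rwa [adjoint_adjoint] at this

theorem isLinearMap_apply (c : Circuit ι) : IsLinearMap ℂ c.apply := by
  induction c with
  | nil => exact ⟨fun _ _ => rfl, fun _ _ => rfl⟩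
  | cons ly c ih =>
    exact ⟨fun φ ψ => by simp only [apply_cons, ly.isLinearMap_apply.map_add, ih.map_add],
      fun a φ => by simp only [apply_cons, ly.isLinearMap_apply.map_smul, ih.map_smul]⟩

theorem depth_append (c d : Circuit ι) : depth (c ++ d) = c.depth + d.depth := List.length_append

theorem depth_adjoint (c : Circuit ι) : c.adjoint.depth = c.depth := by
  simp [depth, adjoint]

theorem depth_onWires {κ : Type*} [DecidableEq κ] (e : ι ↪ κ) (c : Circuit ι) :
    (c.onWires e).depth = c.depth := by
  simp [depth, onWires]

/-- No gate of the circuit has its target in `s`. -/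
def Avoids (c : Circuit ι) (s : Set ι) : Prop := ∀ ly ∈ c, ∀ g ∈ ly.gates, g.target ∉ s

theorem Avoids.append {c d : Circuit ι} {s : Set ι} (hc : c.Avoids s) (hd : d.Avoids s) :
    Avoids (c ++ d) s := fun ly h => (List.mem_append.1 h).elim (hc ly) (hd ly)

theorem Avoids.adjoint {c : Circuit ι} {s : Set ι} (hc : c.Avoids s) : c.adjoint.Avoids s := by
  intro ly hly g hg
  simp only [Circuit.adjoint, List.mem_reverse, List.mem_map] at hly
  obtain ⟨ly, hly, rfl⟩ := hly
  simp only [Layer.adjoint, List.mem_map] at hg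
  obtain ⟨g, hg, rfl⟩ := hg
  exact hc ly hly g hg

theorem avoids_onWires {κ : Type*} [DecidableEq κ] (e : ι ↪ κ) (c : Circuit ι) {s : Set κ}
    (h : ∀ i, e i ∉ s) : (c.onWires e).Avoids s := by
  intro ly hly g hg
  simp only [onWires, List.mem_map] at hly
  obtain ⟨ly, hly, rfl⟩ := hly
  simp only [Layer.map, List.mem_map] at hg
  obtain ⟨g, hg, rfl⟩ := hg
  exact h _

/-- The amplitudes vanish unless all qubits of `s` are `0`. -/
def Clean (s : Set ι) (ψ : (ι → Bool) → ℂ) : Prop := ∀ x, (∃ i ∈ s, x i = true) → ψ x = 0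

omit [DecidableEq ι] in
theorem clean_zeroState (s : Set ι) : Clean s (zeroState ι) := by
  rintro x ⟨i, -, hi⟩
  rw [zeroState, if_neg]
  intro h
  simp [h i] at hi

/-- A gate mixes only strings that differ at its target, so a qubit outside its target that was
surely `0` remains so. -/
theorem _root_.QCTSP.Gate.clean_apply {g : Gate ι} {s : Set ι} (hg : g.target ∉ s)
    {ψ : (ι → Bool) → ℂ} (hψ : Clean s ψ) : Clean s (g.apply ψ) := by
  rintro x ⟨i, hi, hx⟩
  have : ∀ b, ψ (Function.update x g.target b) = 0 := fun b =>
    hψ _ ⟨i, hi, by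
      rwa [Function.update_of_ne]
      rintro rfl
      exact hg hi⟩
  simp only [Gate.apply, this, hψ x ⟨i, hi, hx⟩]
  simp

theorem Avoids.clean_apply {c : Circuit ι} {s : Set ι} (hc : c.Avoids s) {ψ : (ι → Bool) → ℂ}
    (hψ : Clean s ψ) : Clean s (c.apply ψ) := by
  induction c generalizing ψ with
  | nil => exact hψ
  | cons ly c ih =>
    refine ih (fun l hl => hc l (List.mem_cons_of_mem _ hl)) ?_
    have : ∀ gs : List (Gate ι), (∀ g ∈ gs, g.target ∉ s) → ∀ φ, Clean s φ →
        Clean s (gs.foldl (fun φ g => g.apply φ) φ) := by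
      intro gs
      induction gs with
      | nil => exact fun _ _ h => h
      | cons g gs ih' =>
        exact fun h φ hφ => ih' (fun k hk => h k (List.mem_cons_of_mem _ hk)) _
          (Gate.clean_apply (h g List.mem_cons_self) hφ)
    exact this _ (hc ly List.mem_cons_self) _ hψ

theorem outcomeProb_nonneg (c : Circuit ι) (x : ι → Bool) : 0 ≤ c.outcomeProb x := sq_nonneg _

section Fintype

variable [Fintype ι]

theorem dotProduct_apply_apply (c : Circuit ι) (φ ψ : (ι → Bool) → ℂ) :
    star (c.apply φ) ⬝ᵥ c.apply ψ = star φ ⬝ᵥ ψ := by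
  induction c generalizing φ ψ with
  | nil => rfl
  | cons ly c ih => rw [apply_cons, apply_cons, ih, Layer.dotProduct_apply_apply]

omit [DecidableEq ι] in
theorem zeroState_eq_ite (x : ι → Bool) :
    zeroState ι x = if x = fun _ => false then 1 else 0 := by
  simp only [zeroState, funext_iff]
  congr

theorem star_zeroState_dotProduct (ψ : (ι → Bool) → ℂ) :
    star (zeroState ι) ⬝ᵥ ψ = ψ fun _ => false := by
  simp [dotProduct, zeroState_eq_ite, apply_ite]

theorem star_dotProduct_self (ψ : (ι → Bool) → ℂ) :
    star ψ ⬝ᵥ ψ = ((∑ x, ‖ψ x‖ ^ 2 : ℝ) : ℂ) := by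
  simp [dotProduct, Complex.conj_mul']

theorem sum_outcomeProb (c : Circuit ι) : ∑ x, c.outcomeProb x = 1 := by
  have h := star_dotProduct_self (c.apply (zeroState ι))
  rw [dotProduct_apply_apply, star_zeroState_dotProduct] at h
  have : (zeroState ι fun _ => false) = 1 := by simp [zeroState]
  rw [this] at h
  exact_mod_cast h.symm

end Fintype

section Sum

variable {β : Type*} [DecidableEq β]

/-- No embedded gate reads or changes a qubit of `β`, so the circuit acts separately on each slice
of the state with fixed `y`. -/
theorem onWires_inl_apply (c : Circuit ι) (ψ : (ι ⊕ β → Bool) → ℂ) (x : ι → Bool) (y : β → Bool) :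
    (c.onWires Function.Embedding.inl).apply ψ (Sum.elim x y) =
      c.apply (fun x => ψ (Sum.elim x y)) x := by
  have hg : ∀ (g : Gate ι) (ψ : (ι ⊕ β → Bool) → ℂ),
      (fun x => (g.map Function.Embedding.inl).apply ψ (Sum.elim x y)) =
        g.apply (fun x => ψ (Sum.elim x y)) := by
    intro g ψ
    funext x
    have hc : (∀ c ∈ (g.map (Function.Embedding.inl (β := β))).controls, Sum.elim x y c = true) ↔
        ∀ c ∈ g.controls, x c = true := by
      simp only [Gate.map, Finset.forall_mem_map, Function.Embedding.inl_apply, Sum.elim_inl]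
    rw [Gate.apply_eq, Gate.apply_eq]
    simp only [hc]
    refine if_congr Iff.rfl (Finset.sum_congr rfl fun b _ => ?_) rfl
    rw [show (g.map (Function.Embedding.inl (β := β))).target = Sum.inl g.target from rfl,
      ← Sum.update_elim_inl]
    rfl
  have hl : ∀ (gs : List (Gate ι)) (ψ : (ι ⊕ β → Bool) → ℂ),
      (fun x => (gs.map (Gate.map Function.Embedding.inl)).foldl (fun φ g => g.apply φ) ψ
        (Sum.elim x y)) = gs.foldl (fun φ g => g.apply φ) (fun x => ψ (Sum.elim x y)) := by
    intro gs
    induction gs with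
    | nil => exact fun _ => rfl
    | cons g gs ih => intro ψ; simp only [List.map_cons, List.foldl_cons]; rw [ih, hg]
  have hcirc : ∀ ψ : (ι ⊕ β → Bool) → ℂ,
      (fun x => (c.onWires Function.Embedding.inl).apply ψ (Sum.elim x y)) =
        c.apply (fun x => ψ (Sum.elim x y)) := by
    induction c with
    | nil => exact fun _ => rfl
    | cons ly c ih =>
      intro ψ
      rw [apply_cons, show onWires (Function.Embedding.inl (β := β)) (ly :: c) =
        ly.map Function.Embedding.inl :: onWires Function.Embedding.inl c from rfl]
      simp only [apply_cons]
      rw [ih]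
      exact congrArg _ (hl ly.gates ψ)
  exact congrFun (hcirc ψ) x

theorem onWires_inl_apply_zeroState [Fintype β] (c : Circuit ι) (x : ι → Bool) (y : β → Bool) :
    (c.onWires Function.Embedding.inl).apply (zeroState (ι ⊕ β)) (Sum.elim x y) =
      if ∀ i, y i = false then c.apply (zeroState ι) x else 0 := by
  rw [onWires_inl_apply]
  split_ifs with h
  · congr 1
    funext x
    have : (∀ i, Sum.elim x y i = false) ↔ ∀ i, x i = false := by simp [h]
    unfold zeroState
    by_cases hx : ∀ i, x i = false
    · rw [if_pos hx, if_pos (this.2 hx)]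
    · rw [if_neg hx, if_neg (mt this.1 hx)]
  · have : (fun x : ι → Bool => zeroState (ι ⊕ β) (Sum.elim x y)) = 0 := by
      funext x
      simp only [zeroState, Sum.forall, Sum.elim_inr, h, and_false, if_false, Pi.zero_apply]
    rw [this, c.isLinearMap_apply.map_zero]
    rfl

theorem sum_onWires_inl [Fintype ι] [Fintype β] (c : Circuit ι) (F : (ι ⊕ β → Bool) → ℝ) :
    ∑ z, F z * (c.onWires Function.Embedding.inl).outcomeProb z =
      ∑ x, F (Sum.elim x fun _ => false) * c.outcomeProb x := by
  rw [← (Equiv.sumArrowEquivProdArrow ι β Bool).symm.sum_comp, Fintype.sum_prod_type]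
  refine Finset.sum_congr rfl fun x _ => ?_
  rw [Finset.sum_eq_single (fun _ => false)]
  · simp [Equiv.sumArrowEquivProdArrow, outcomeProb, onWires_inl_apply_zeroState]
  · intro y _ hy
    have : ¬ ∀ i, y i = false := fun h => hy (funext h)
    simp [Equiv.sumArrowEquivProdArrow, outcomeProb, onWires_inl_apply_zeroState, this]
  · simp

end Sum

end Circuit

/-! ### Phase flips, controlled bit flips and controlled rotations. -/

namespace Gate

variable {ι : Type*} [DecidableEq ι]

/-- The phase flip on the qubit `t`. -/
def pauliZ (t : ι) : Gate ι where
  target := t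
  controls := ∅
  target_notMem := Finset.notMem_empty t
  mat := ⟨Matrix.diagonal fun b => if b then -1 else 1, by
    rw [Matrix.mem_unitaryGroup_iff, Matrix.star_eq_conjTranspose, Matrix.diagonal_conjTranspose,
      Matrix.diagonal_mul_diagonal, ← Matrix.diagonal_one]
    congr 1
    funext b
    cases b <;> simp⟩

/-- The bit flip on the qubit `t`, controlled on the qubits of `C` other than `t`. -/
def mcx (t : ι) (C : Finset ι) : Gate ι where
  target := t
  controls := C.erase t
  target_notMem := Finset.notMem_erase t C
  mat := ⟨Matrix.of fun a b => if a = b then 0 else 1, by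
    rw [Matrix.mem_unitaryGroup_iff]
    ext a b
    cases a <;> cases b <;> simp [Matrix.mul_apply, Matrix.star_apply]⟩

theorem rotation_mul (α β : ℝ) : rotation α * rotation β = rotation (α + β) := by
  ext a b
  cases a <;> cases b <;>
    simp only [rotation, Matrix.mul_apply, Fintype.sum_bool, Matrix.of_apply, Real.cos_add,
      Real.sin_add] <;> push_cast <;> ring

theorem rotation_zero : rotation 0 = 1 := by
  ext a b
  cases a <;> cases b <;> simp [rotation]

theorem rotation_mem (θ : ℝ) : rotation θ ∈ Matrix.unitaryGroup Bool ℂ := by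
  have hs : star (rotation θ) = rotation (-θ) := by
    ext a b
    cases a <;> cases b <;>
      simp [rotation, Matrix.star_apply, -Complex.ofReal_sin, -Complex.ofReal_cos]
  rw [Matrix.mem_unitaryGroup_iff, hs, rotation_mul, add_neg_cancel,
    rotation_zero]

/-- The rotation by `θ` of the qubit `t`, controlled on the qubits of `C` other than `t`. -/
def crot (t : ι) (C : Finset ι) (θ : ℝ) : Gate ι where
  target := t
  controls := C.erase t
  target_notMem := Finset.notMem_erase t C
  mat := ⟨rotation θ, rotation_mem θ⟩

theorem pauliZ_apply (t : ι) (ψ : (ι → Bool) → ℂ) (x : ι → Bool) :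
    (pauliZ t).apply ψ x = (if x t then -1 else 1) * ψ x := by
  have : ∀ a b, (pauliZ t).entry a b = if a = b then (if b then -1 else 1) else 0 := by
    intro a b
    simp only [entry, pauliZ, Matrix.diagonal_apply]
    aesop
  rw [apply_eq, if_pos (by simp [pauliZ])]
  simp only [this, show (pauliZ t).target = t from rfl]
  cases hx : x t <;> simp [← hx]

/-- The action of a controlled bit flip on bit strings. -/
def bitFlip (t : ι) (C : Finset ι) (x : ι → Bool) : ι → Bool :=
  if ∀ c ∈ C.erase t, x c = true then Function.update x t (!x t) else x

theorem bitFlip_bitFlip (t : ι) (C : Finset ι) (x : ι → Bool) :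
    bitFlip t C (bitFlip t C x) = x := by
  have : ∀ b, (∀ c ∈ C.erase t, Function.update x t b c = true) ↔ ∀ c ∈ C.erase t, x c = true :=
    fun b => forall₂_congr fun c hc => by rw [Function.update_of_ne (Finset.ne_of_mem_erase hc)]
  by_cases h : ∀ c ∈ C.erase t, x c = true
  · rw [bitFlip, bitFlip, if_pos h, if_pos ((this _).2 h)]
    simp
  · rw [bitFlip, bitFlip, if_neg h, if_neg h]

theorem mcx_apply (t : ι) (C : Finset ι) (ψ : (ι → Bool) → ℂ) (x : ι → Bool) :
    (mcx t C).apply ψ x = ψ (bitFlip t C x) := by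
  rw [apply_eq, bitFlip]
  simp only [show (mcx t C).controls = C.erase t from rfl, show (mcx t C).target = t from rfl]
  have : ∀ a b, (mcx t C).entry a b = if a = b then 0 else 1 := fun a b => rfl
  simp only [this]
  split_ifs
  · cases hx : x t <;> simp
  · rfl

theorem elementary_pauliZ (t : ι) : (pauliZ t).Elementary := by
  simp [Elementary, pauliZ]

theorem elementary_mcx (t : ι) {C : Finset ι} (h : C.card ≤ 2) : (mcx t C).Elementary :=
  (Finset.card_le_card (Finset.erase_subset _ _)).trans h

theorem elementary_crot (t : ι) {C : Finset ι} (θ : ℝ) (h : C.card ≤ 2) :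
    (crot t C θ).Elementary :=
  (Finset.card_le_card (Finset.erase_subset _ _)).trans h

end Gate

namespace Layer

variable {ι : Type*} [DecidableEq ι]

theorem elementary_single {g : Gate ι} (h : g.Elementary) : (single g).Elementary := by
  intro g' hg'
  rwa [List.mem_singleton.1 hg']

theorem elementary_adjoint {ly : Layer ι} (h : ly.Elementary) : ly.adjoint.Elementary := by
  intro g hg
  simp only [adjoint, List.mem_map] at hg
  obtain ⟨g, hg, rfl⟩ := hg
  exact h g hg

end Layer

namespace Circuit

variable {ι : Type*} [DecidableEq ι]

/-- One gate in each layer. -/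
def ofGates (gs : List (Gate ι)) : Circuit ι := gs.map Layer.single

theorem depth_ofGates (gs : List (Gate ι)) : (ofGates gs).depth = gs.length := by
  simp [ofGates, depth]

theorem ofGates_avoids {gs : List (Gate ι)} {s : Set ι} (h : ∀ g ∈ gs, g.target ∉ s) :
    (ofGates gs).Avoids s := by
  intro ly hly g hg
  simp only [ofGates, List.mem_map] at hly
  obtain ⟨g', hg', rfl⟩ := hly
  rw [Layer.single, List.mem_singleton] at hg
  exact hg ▸ h g' hg'

/-! Controlled rotations of one qubit. -/

/-- The rotations of the qubit `t` by given angles, with given controls. -/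
def rotations (t : ι) (l : List (Finset ι × ℝ)) : Circuit ι :=
  ofGates (l.map fun p => Gate.crot t p.1 p.2)

/-- The sum of the angles of the rotations whose controls are `1`. -/
def totalAngle (l : List (Finset ι × ℝ)) (x : ι → Bool) : ℝ :=
  (l.map fun p => if ∀ c ∈ p.1, x c = true then p.2 else 0).sum

/-- All the rotations act in the same plane, so their angles add. No control set contains `t`, so
which rotations are active does not depend on the earlier ones. -/
theorem rotations_apply {t : ι} {l : List (Finset ι × ℝ)} (hl : ∀ p ∈ l, t ∉ p.1)
    (ψ : (ι → Bool) → ℂ) (x : ι → Bool) :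
    (rotations t l).apply ψ x =
      ∑ b, rotation (totalAngle l x) (x t) b * ψ (Function.update x t b) := by
  induction l generalizing ψ with
  | nil =>
    rw [show (rotations t [] : Circuit ι).apply ψ x = ψ x from rfl]
    simp [totalAngle, Gate.rotation_zero, Matrix.one_apply]
  | cons p l ih =>
    have hp := hl p List.mem_cons_self
    have hc : ∀ b, (∀ c ∈ p.1, Function.update x t b c = true) ↔ ∀ c ∈ p.1, x c = true :=
      fun b => forall₂_congr fun c hc => by
        rw [Function.update_of_ne]
        rintro rfl
        exact hp hc
    have h1 : ∀ b, (Gate.crot t p.1 p.2).apply ψ (Function.update x t b) =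
        ∑ b', rotation (if ∀ c ∈ p.1, x c = true then p.2 else 0) b b' *
          ψ (Function.update x t b') := by
      intro b
      rw [Gate.apply_eq]
      simp only [show (Gate.crot t p.1 p.2).controls = p.1 by
        simp [Gate.crot, Finset.erase_eq_of_notMem hp], hc,
        show (Gate.crot t p.1 p.2).target = t from rfl]
      split_ifs
      · simp only [Function.update_self, Function.update_idem]
        rfl
      · cases b <;> simp [rotation]
    rw [show rotations t (p :: l) = Layer.single (Gate.crot t p.1 p.2) :: rotations t l from rfl,
      apply_cons, ih fun p hp => hl p (List.mem_cons_of_mem _ hp)]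
    have h2 : totalAngle (p :: l) x =
        totalAngle l x + if ∀ c ∈ p.1, x c = true then p.2 else 0 := by
      simp [totalAngle, add_comm]
    rw [h2, ← Gate.rotation_mul]
    simp only [show ∀ φ, (Layer.single (Gate.crot t p.1 p.2)).apply φ =
      (Gate.crot t p.1 p.2).apply φ from fun _ => rfl, h1, Matrix.mul_apply, Fintype.sum_bool]
    ring

theorem totalAngle_update {t : ι} {l : List (Finset ι × ℝ)} (hl : ∀ p ∈ l, t ∉ p.1)
    (x : ι → Bool) (b : Bool) : totalAngle l (Function.update x t b) = totalAngle l x := by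
  unfold totalAngle
  congr 1
  refine List.map_congr_left fun p hp => if_congr ?_ rfl rfl
  refine forall₂_congr fun c hc => ?_
  rw [Function.update_of_ne]
  rintro rfl
  exact hl p hp hc

/-- Rotating a qubit that is `0` makes it `1` with probability the mean of the squared sine. -/
theorem sum_rotations [Fintype ι] {t : ι} {l : List (Finset ι × ℝ)} (hl : ∀ p ∈ l, t ∉ p.1)
    {ψ : (ι → Bool) → ℂ} (hψ : Clean {t} ψ) :
    ∑ x, (if x t then ‖(rotations t l).apply ψ x‖ ^ 2 else 0) =
      ∑ x, Real.sin (totalAngle l x) ^ 2 * ‖ψ x‖ ^ 2 := by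
  have hinv : Function.Involutive fun x : ι → Bool => Function.update x t (!x t) := by
    intro x
    simp
  -- Flipping `t` in the summation index matches each final amplitude with `t = 1` to the initial
  -- amplitude with `t = 0` from which it comes.
  rw [← Equiv.sum_comp hinv.toPerm]
  refine Finset.sum_congr rfl fun x _ => ?_
  simp only [Function.Involutive.coe_toPerm, rotations_apply hl, totalAngle_update hl,
    Function.update_self,
    Function.update_idem]
  cases hx : x t with
  | false =>
    have h1 : ψ (Function.update x t true) = 0 := hψ _ ⟨t, rfl, by simp⟩
    have h0 : Function.update x t false = x := by rw [← hx, Function.update_eq_self]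
    simp [h1, h0, rotation, mul_pow, -Complex.ofReal_sin]
  | true =>
    have h1 : ψ x = 0 := hψ x ⟨t, rfl, hx⟩
    simp [h1]

/-! The reflection about the zero state. -/

/-- A sequence of controlled bit flips. -/
def flips (l : List (ι × Finset ι)) : Circuit ι := ofGates (l.map fun p => Gate.mcx p.1 p.2)

theorem flips_apply (l : List (ι × Finset ι)) (ψ : (ι → Bool) → ℂ) (x : ι → Bool) :
    (flips l).apply ψ x = ψ (l.foldr (fun p x => Gate.bitFlip p.1 p.2 x) x) := by
  induction l generalizing ψ with
  | nil => rfl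
  | cons p l ih =>
    rw [show flips (p :: l) = Layer.single (Gate.mcx p.1 p.2) :: flips l from rfl, apply_cons, ih]
    exact Gate.mcx_apply _ _ _ _

/-- The sequence of controlled bit flips, a phase flip on `t`, and the bit flips undone. -/
def flipConj (l : List (ι × Finset ι)) (t : ι) : Circuit ι :=
  flips l ++ (ofGates [Gate.pauliZ t] ++ flips l.reverse)

/-- Conjugating a diagonal operator by a permutation of the basis leaves it diagonal, with the sign
read off the permuted string. The reversed list inverts the permutation because each flip is an
involution. -/
theorem flipConj_apply (l : List (ι × Finset ι)) (t : ι) (ψ : (ι → Bool) → ℂ) (x : ι → Bool) :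
    (flipConj l t).apply ψ x =
      (if l.foldl (fun x p => Gate.bitFlip p.1 p.2 x) x t then -1 else 1) * ψ x := by
  have hinv : ∀ x, l.foldr (fun p x => Gate.bitFlip p.1 p.2 x)
      (l.foldl (fun x p => Gate.bitFlip p.1 p.2 x) x) = x := by
    induction l with
    | nil => exact fun _ => rfl
    | cons p l ih =>
      intro x
      rw [List.foldl_cons, List.foldr_cons, ih, Gate.bitFlip_bitFlip]
  rw [flipConj, apply_append, apply_append, flips_apply, List.foldr_reverse]
  rw [show (ofGates [Gate.pauliZ t] : Circuit ι).apply = (Gate.pauliZ t).apply from rfl,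
    Gate.pauliZ_apply, flips_apply, hinv]

/-- Bit flips that compute into the second qubit of each pair the disjunction of the first qubits
of the pairs up to this one, and of the qubit `p`. -/
def orLadder : ι → List (ι × ι) → List (ι × Finset ι)
  | _, [] => []
  | p, (q, a) :: l => (a, {p}) :: (a, {q}) :: (a, {p, q}) :: orLadder a l

/-- The qubit on which the ladder leaves its result. -/
def orResult : ι → List (ι × ι) → ι
  | p, [] => p
  | _, (_, a) :: l => orResult a l

theorem length_orLadder (p : ι) (l : List (ι × ι)) : (orLadder p l).length = 3 * l.length := by
  induction l generalizing p with
  | nil => rfl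
  | cons r l ih => simp only [orLadder, List.length_cons, ih]; ring

theorem card_le_of_mem_orLadder {p : ι} {l : List (ι × ι)} {r : ι × Finset ι}
    (h : r ∈ orLadder p l) : r.2.card ≤ 2 := by
  induction l generalizing p with
  | nil => simp [orLadder] at h
  | cons s l ih =>
    simp only [orLadder, List.mem_cons] at h
    rcases h with rfl | rfl | rfl | h
    · simp
    · simp
    · exact Finset.card_le_two
    · exact ih h

/-- On a clean qubit, the three flips add `p`, `q` and `pq` modulo 2, and this sum is `p ∨ q`. The
hypotheses on the list keep the ladder qubits distinct from the qubits that are read, so the later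
ones are still `0` when their turn comes. -/
theorem foldl_orLadder {p : ι} {l : List (ι × ι)} (hnd : (l.map Prod.snd).Nodup)
    (hd : ∀ a ∈ l.map Prod.snd, a ∉ l.map Prod.fst) (hp : p ∉ l.map Prod.snd) {x : ι → Bool}
    (hx : ∀ a ∈ l.map Prod.snd, x a = false) :
    (orLadder p l).foldl (fun x p => Gate.bitFlip p.1 p.2 x) x (orResult p l) =
      (x p || l.any fun r => x r.1) := by
  induction l generalizing p x with
  | nil => simp [orLadder, orResult]
  | cons r l ih =>
    obtain ⟨q, a⟩ := r
    simp only [List.map_cons, List.nodup_cons, List.mem_cons, forall_eq_or_imp, not_or] at *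
    have hpa : p ≠ a := hp.1
    have hqa : q ≠ a := fun h => hd.1.1 h.symm
    have hstep : Gate.bitFlip a {p, q} (Gate.bitFlip a {q} (Gate.bitFlip a {p} x)) =
        Function.update x a (x p || x q) := by
      have h1 : ∀ c ≠ a, ∀ y : ι → Bool, Gate.bitFlip a {c} y =
          if y c then Function.update y a (!y a) else y := by
        intro c hc y
        rw [Gate.bitFlip, Finset.erase_eq_of_notMem (by simpa using hc.symm)]
        simp
      have h2 : ∀ y : ι → Bool, Gate.bitFlip a {p, q} y =
          if y p ∧ y q then Function.update y a (!y a) else y := by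
        intro y
        rw [Gate.bitFlip, Finset.erase_eq_of_notMem (by simp [hpa.symm, hqa.symm])]
        simp
      have h0 : Function.update x a false = x := by rw [← hx.1, Function.update_eq_self]
      rw [h1 p hpa, h1 q hqa, h2]
      cases hxp : x p <;> cases hxq : x q <;>
        simp [hxp, hxq, hx.1, Function.update_of_ne hpa, Function.update_of_ne hqa, h0]
    simp only [orLadder, orResult, List.foldl_cons, hstep]
    rw [ih hnd.2 (fun b hb => (hd.2 b hb).2) hnd.1]
    · simp only [Function.update_self, List.any_cons, Bool.or_assoc]
      congr 2
      rw [Bool.eq_iff_iff, List.any_eq_true, List.any_eq_true]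
      refine exists_congr fun s => and_congr_right fun hs => ?_
      rw [Function.update_of_ne]
      rintro rfl
      exact hd.1.2 (List.mem_map_of_mem hs)
    · intro b hb
      rw [Function.update_of_ne]
      · exact hx.2 b hb
      · rintro rfl
        exact hnd.1 hb

/-- Twice the projection to the zero state minus the identity, on states whose ladder qubits
are clean. -/
def reflectZero (p : ι) (l : List (ι × ι)) : Circuit ι := flipConj (orLadder p l) (orResult p l)

theorem depth_reflectZero (p : ι) (l : List (ι × ι)) :
    (reflectZero p l).depth = 6 * l.length + 1 := by
  simp only [reflectZero, flipConj, flips, depth_append, depth_ofGates, List.length_map,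
    List.length_reverse, length_orLadder, List.length_singleton]
  ring

theorem reflectZero_elementary (p : ι) (l : List (ι × ι)) :
    ∀ ly ∈ reflectZero p l, Layer.Elementary ly := by
  intro ly hly
  simp only [reflectZero, flipConj, flips, ofGates, List.map_map, List.mem_append, List.mem_map,
    List.mem_reverse, List.mem_singleton] at hly
  rcases hly with ⟨r, hr, rfl⟩ | ⟨_, rfl, rfl⟩ | ⟨r, hr, rfl⟩
  · exact Layer.elementary_single (Gate.elementary_mcx _ (card_le_of_mem_orLadder hr))
  · exact Layer.elementary_single (Gate.elementary_pauliZ _)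
  · exact Layer.elementary_single (Gate.elementary_mcx _ (card_le_of_mem_orLadder hr))

/-- On a basis string with clean ladder qubits, the ladder yields `1` exactly when some tested qubit
is `1`. By `hall` this means that the string is not zero, so the sign is `-1` everywhere except at
the zero string. -/
theorem reflectZero_apply {p : ι} {l : List (ι × ι)} (hnd : (l.map Prod.snd).Nodup)
    (hd : ∀ a ∈ l.map Prod.snd, a ∉ l.map Prod.fst) (hp : p ∉ l.map Prod.snd)
    (hall : ∀ i, i = p ∨ i ∈ l.map Prod.fst ∨ i ∈ l.map Prod.snd)
    {χ : (ι → Bool) → ℂ} (hχ : Clean {i | i = p ∨ i ∈ l.map Prod.snd} χ) :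
    (reflectZero p l).apply χ = (2 * χ fun _ => false) • zeroState ι - χ := by
  funext x
  rw [reflectZero, flipConj_apply]
  simp only [Pi.sub_apply, Pi.smul_apply, smul_eq_mul]
  by_cases hx : ∃ i ∈ {i | i = p ∨ i ∈ l.map Prod.snd}, x i = true
  · rw [hχ x hx, clean_zeroState _ x hx]
    ring
  · simp only [Set.mem_ofPred_eq, not_exists, not_and, Bool.not_eq_true] at hx
    rw [foldl_orLadder hnd hd hp fun a ha => hx a (Or.inr ha), hx p (Or.inl rfl), Bool.false_or]
    by_cases hq : l.any (fun r => x r.1) = true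
    · rw [if_pos hq]
      obtain ⟨r, -, hr⟩ := List.any_eq_true.1 hq
      rw [clean_zeroState {r.1} x ⟨r.1, rfl, hr⟩]
      ring
    · rw [if_neg hq]
      have h0 : x = fun _ => false := by
        funext i
        rcases hall i with h | h | h
        · exact hx i (Or.inl h)
        · obtain ⟨r, hr, rfl⟩ := List.mem_map.1 h
          by_contra hne
          exact hq (List.any_eq_true.2 ⟨r, hr, by simpa using hne⟩)
        · exact hx i (Or.inr h)
      subst h0
      simp only [zeroState, implies_true, if_true]
      ring

/-! Amplitude amplification. -/

/-- One step of amplitude amplification for the qubit `t` in the state prepared by `V`, where `S`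
reflects about the zero state. -/
def groverStep (V S : Circuit ι) (t : ι) : Circuit ι :=
  ofGates [Gate.pauliZ t] ++ (V.adjoint ++ (S ++ V))

/-- The state prepared by `V` after `k` steps of amplitude amplification. -/
def amplify (V S : Circuit ι) (t : ι) (k : ℕ) : Circuit ι :=
  V ++ (List.replicate k (groverStep V S t)).flatten

theorem depth_amplify (V S : Circuit ι) (t : ι) (k : ℕ) :
    (amplify V S t k).depth = V.depth + k * (2 * V.depth + S.depth + 1) := by
  have : (groverStep V S t).depth = 2 * V.depth + S.depth + 1 := by
    simp only [groverStep, depth_append, depth_adjoint, depth_ofGates, List.length_singleton]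
    ring
  rw [amplify, depth_append]
  unfold depth at *
  simp [this]

/-- In the plane spanned by the two parts of the prepared state with `t = 1` and `t = 0`, a step is
a product of two reflections, hence a rotation by `2θ`. The hypothesis on `S` covers clean states
only; it applies because neither `V` nor its adjoint targets a qubit of `s`. -/
theorem amplify_apply [Fintype ι] {V S : Circuit ι} {t : ι} {s : Set ι} {θ : ℝ}
    (hV : V.Avoids s)
    (hS : ∀ χ, Clean s χ → S.apply χ = (2 * χ fun _ => false) • zeroState ι - χ)
    (hθ : ∑ x, (if x t then V.outcomeProb x else 0) = Real.sin θ ^ 2)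
    (hsin : Real.sin θ ≠ 0) (hcos : Real.cos θ ≠ 0) (k : ℕ) (x : ι → Bool) :
    (amplify V S t k).apply (zeroState ι) x =
      ((if x t then Real.sin ((2 * k + 1) * θ) / Real.sin θ
        else Real.cos ((2 * k + 1) * θ) / Real.cos θ : ℝ) : ℂ) * V.apply (zeroState ι) x := by
  induction k generalizing x with
  | zero =>
    have : (amplify V S t 0).apply (zeroState ι) = V.apply (zeroState ι) := by
      simp [amplify]
    rw [this]
    split_ifs <;> simp [-Complex.ofReal_sin, -Complex.ofReal_cos, hsin, hcos]
  | succ k ih =>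
    set Ψ := V.apply (zeroState ι) with hΨ
    have hsplit : amplify V S t (k + 1) = amplify V S t k ++ groverStep V S t := by
      simp [amplify, List.replicate_succ']
    set A := (2 * k + 1) * θ with hA
    set φ : (ι → Bool) → ℂ := fun x => ((if x t then -(Real.sin A / Real.sin θ)
      else Real.cos A / Real.cos θ : ℝ) : ℂ) * Ψ x with hφ
    have hZ : (Gate.pauliZ t).apply ((amplify V S t k).apply (zeroState ι)) = φ := by
      funext y
      rw [Gate.pauliZ_apply, ih, hφ]
      simp only
      split_ifs <;> push_cast <;> ring
    have hΨc : Clean s Ψ := hV.clean_apply (clean_zeroState s)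
    have hφc : Clean s φ := fun y hy => by simp only [hφ, hΨc y hy, mul_zero]
    have hstep : (groverStep V S t).apply ((amplify V S t k).apply (zeroState ι)) =
        (2 * (star Ψ ⬝ᵥ φ)) • Ψ - φ := by
      rw [groverStep, apply_append, apply_append, apply_append,
        show (ofGates [Gate.pauliZ t] : Circuit ι).apply = (Gate.pauliZ t).apply from rfl, hZ,
        hS _ (hV.adjoint.clean_apply hφc), V.isLinearMap_apply.map_sub,
        V.isLinearMap_apply.map_smul, apply_adjoint_apply, ← star_zeroState_dotProduct (V.adjoint.apply φ),
        ← dotProduct_apply_apply V, apply_adjoint_apply]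
    have h1 : ∑ x, (if x t then 0 else V.outcomeProb x) = Real.cos θ ^ 2 := by
      have := V.sum_outcomeProb
      rw [Real.cos_sq', ← hθ, eq_sub_iff_add_eq, ← Finset.sum_add_distrib, ← this]
      refine Finset.sum_congr rfl fun x _ => ?_
      split_ifs <;> simp
    -- The overlap is `cos A cos θ - sin A sin θ`.
    have hip : star Ψ ⬝ᵥ φ = ((Real.cos (A + θ) : ℝ) : ℂ) := by
      have : star Ψ ⬝ᵥ φ = ((∑ x, (-(Real.sin A / Real.sin θ) *
          (if x t then V.outcomeProb x else 0) + Real.cos A / Real.cos θ *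
          (if x t then 0 else V.outcomeProb x)) : ℝ) : ℂ) := by
        rw [dotProduct, Complex.ofReal_sum]
        refine Finset.sum_congr rfl fun x _ => ?_
        have hn : (starRingEnd ℂ) (Ψ x) * Ψ x = ((V.outcomeProb x : ℝ) : ℂ) := by
          rw [Complex.conj_mul', outcomeProb]
          push_cast
          rfl
        rw [hφ, Pi.star_apply]
        simp only [RCLike.star_def]
        rw [mul_left_comm, hn]
        split_ifs <;> push_cast <;> ring
      rw [this, Finset.sum_add_distrib, ← Finset.mul_sum, ← Finset.mul_sum, hθ, h1, Real.cos_add]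
      congr 1
      field_simp
      ring
    rw [hsplit, apply_append, hstep, hip]
    simp only [Pi.sub_apply, Pi.smul_apply, smul_eq_mul, hφ]
    have hA2 : (2 * ((k + 1 : ℕ) : ℝ) + 1) * θ = (A + θ) + θ := by rw [hA]; push_cast; ring
    have hA3 : A = (A + θ) - θ := by ring
    rw [← sub_mul, hA2]
    congr 1
    rw [show (2 : ℂ) = ((2 : ℝ) : ℂ) by norm_num, ← Complex.ofReal_mul, ← Complex.ofReal_sub]
    congr 1
    -- These are `sin(A+2θ) - sin A = 2 cos(A+θ) sin θ` and `cos(A+2θ) + cos A = 2 cos(A+θ) cos θ`.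
    split_ifs
    · rw [Real.sin_add (A + θ)]
      nth_rewrite 2 [hA3]
      rw [Real.sin_sub]
      field_simp
      ring
    · rw [Real.cos_add (A + θ)]
      nth_rewrite 2 [hA3]
      rw [Real.cos_sub]
      field_simp
      ring

theorem sum_amplify [Fintype ι] {V S : Circuit ι} {t : ι} {s : Set ι} {θ : ℝ}
    (hV : V.Avoids s)
    (hS : ∀ χ, Clean s χ → S.apply χ = (2 * χ fun _ => false) • zeroState ι - χ)
    (hθ : ∑ x, (if x t then V.outcomeProb x else 0) = Real.sin θ ^ 2)
    (hsin : Real.sin θ ≠ 0) (hcos : Real.cos θ ≠ 0) (k : ℕ) :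
    ∑ x, (if x t then (amplify V S t k).outcomeProb x else 0) =
      Real.sin ((2 * k + 1) * θ) ^ 2 := by
  have : ∀ x, (if x t then (amplify V S t k).outcomeProb x else 0) =
      (Real.sin ((2 * k + 1) * θ) / Real.sin θ) ^ 2 *
        (if x t then V.outcomeProb x else 0) := by
    intro x
    split_ifs with h
    · rw [outcomeProb, amplify_apply hV hS hθ hsin hcos, if_pos h, norm_mul, mul_pow, outcomeProb,
        Complex.norm_real, Real.norm_eq_abs, sq_abs]
    · simp
  rw [Finset.sum_congr rfl fun x _ => this x, ← Finset.mul_sum, hθ]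
  field_simp

end Circuit

/-! Reconstruction of a phase from estimates of cosines of its multiples. -/

/-- The phases that occur: between `arccos (4 / 5)` and `π / 3`. -/
def PhaseRange (φ : ℝ) : Prop := φ ∈ Set.Icc 0 Real.pi ∧ Real.cos φ ∈ Set.Icc (1 / 2) (4 / 5)

/-- The number of amplification steps for the level `j`; there are two circuits in each level. -/
def levelSteps (j : ℕ) (b : Bool) : ℕ := (3 ^ j - 1) / 2 + if b then 1 else 0

/-- The multiple of the phase that is observed after `levelSteps j b` steps. -/
def levelMul (j : ℕ) (b : Bool) : ℝ := 3 ^ j + if b then 2 else 0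

theorem two_mul_levelSteps (j : ℕ) (b : Bool) :
    2 * (levelSteps j b : ℝ) + 1 = levelMul j b := by
  have h : 2 * ((3 ^ j - 1) / 2) + 1 = 3 ^ j := by
    have : (3 ^ j) % 2 = 1 := by rw [Nat.pow_mod]; simp
    generalize 3 ^ j = m at *
    omega
  have h' : 2 * (((3 ^ j - 1) / 2 : ℕ) : ℝ) + 1 = 3 ^ j := by exact_mod_cast h
  unfold levelSteps levelMul
  cases b
  · simpa using h'
  · push_cast
    simp only [if_true]
    linarith

/-- The probability of reading `1` after the amplification steps of the level `j`. -/
def levelProb (φ : ℝ) (j : ℕ) (b : Bool) : ℝ := Real.sin (levelMul j b * (φ / 2)) ^ 2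

theorem levelProb_eq (φ : ℝ) (j : ℕ) (b : Bool) :
    levelProb φ j b = (1 - Real.cos (levelMul j b * φ)) / 2 := by
  rw [levelProb, Real.sin_sq_eq_half_sub]
  ring_nf

theorem PhaseRange.le_pi_div_three {φ : ℝ} (h : PhaseRange φ) : φ ≤ Real.pi / 3 := by
  by_contra! hlt
  have := Real.cos_lt_cos_of_nonneg_of_le_pi (by positivity) h.1.2 hlt
  rw [Real.cos_pi_div_three] at this
  exact absurd h.2.1 (not_le.2 this)

theorem PhaseRange.midpoint {φ ψ : ℝ} (hφ : PhaseRange φ) (hψ : PhaseRange ψ) :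
    PhaseRange ((φ + ψ) / 2) := by
  have key : ∀ {φ ψ : ℝ}, PhaseRange φ → PhaseRange ψ → φ ≤ ψ → PhaseRange ((φ + ψ) / 2) := by
    intro φ ψ hφ hψ hle
    have h1 := Real.cos_le_cos_of_nonneg_of_le_pi hφ.1.1 (show (φ + ψ) / 2 ≤ Real.pi by
      linarith [hφ.1.2, hψ.1.2]) (by linarith)
    have h2 := Real.cos_le_cos_of_nonneg_of_le_pi (show 0 ≤ (φ + ψ) / 2 by
      linarith [hφ.1.1, hψ.1.1]) hψ.1.2 (by linarith)
    exact ⟨⟨by linarith [hφ.1.1, hψ.1.1], by linarith [hφ.1.2, hψ.1.2]⟩,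
      h2.trans' hψ.2.1, h1.trans hφ.2.2⟩
  rcases le_total φ ψ with h | h
  · exact key hφ hψ h
  · rw [add_comm]; exact key hψ hφ h

theorem PhaseRange.sin_ge {φ : ℝ} (h : PhaseRange φ) : 3 / 5 ≤ Real.sin φ := by
  have h0 : 0 ≤ Real.sin φ := Real.sin_nonneg_of_mem_Icc h.1
  have h1 := Real.sin_sq_add_cos_sq φ
  have h2 := h.2.1
  have h3 := h.2.2
  nlinarith

/-- Jordan's inequality. The bound `5/48` is `1/16` divided by `2 · 3/10`: the tolerance for cosines
over twice the guaranteed size of a sine factor. -/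
theorem le_quarter_of_sin_le {x : ℝ} (h0 : 0 ≤ x) (h1 : x ≤ Real.pi / 2)
    (h : Real.sin x ≤ 5 / 48) : x ≤ 1 / 4 := by
  have := Real.mul_le_sin h0 h1
  have hpi := Real.pi_pos
  have hpi' := Real.pi_lt_d2
  have h2 : 2 / Real.pi * x ≤ 5 / 48 := this.trans h
  rw [div_mul_eq_mul_div, div_le_iff₀ hpi] at h2
  nlinarith

/-- With `σ` the midpoint and `d` half the distance, `|cos(mφ) - cos(mψ)| = 2 |sin(mσ)| sin(md)`, so
closeness of the cosines bounds `md` unless `sin(mσ)` is small. Then `sin((m+2)σ)` is not small,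
which is why each level observes two multiples. Each level improves the bound by the factor 3, and
the bound of the previous level keeps the angles in the range where the sine can be inverted. -/
theorem abs_sub_le_of_cos_close {φ ψ : ℝ} (hφ : PhaseRange φ) (hψ : PhaseRange ψ) (i : ℕ)
    (h : ∀ j < i, ∀ b, |Real.cos (levelMul j b * φ) - Real.cos (levelMul j b * ψ)| ≤ 1 / 16) :
    |φ - ψ| ≤ 3 / 2 * (1 / 3) ^ i := by
  have hpi := Real.pi_gt_three
  have hpi' := Real.pi_lt_d2
  set d := |φ - ψ| / 2 with hd
  set σ := (φ + ψ) / 2 with hσ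
  have hd0 : 0 ≤ d := by positivity
  have hmid : PhaseRange σ := hφ.midpoint hψ
  have hsum : ∀ m : ℝ, 0 ≤ m → m * d ≤ Real.pi / 2 →
      |Real.cos (m * φ) - Real.cos (m * ψ)| = 2 * |Real.sin (m * σ)| * Real.sin (m * d) := by
    intro m hm hmd
    have hs : Real.sin (m * d) = |Real.sin (m * ((φ - ψ) / 2))| := by
      have h1 : m * d = |m * ((φ - ψ) / 2)| := by
        rw [abs_mul, abs_of_nonneg hm, abs_div, hd, abs_of_pos (show (0 : ℝ) < 2 by norm_num)]
      have h2 : |m * ((φ - ψ) / 2)| ≤ Real.pi := by rw [← h1]; linarith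
      rw [h1, Real.abs_sin_eq_sin_abs_of_abs_le_pi h2]
    rw [hs, Real.cos_sub_cos, abs_mul, abs_mul, hσ]
    norm_num
    ring_nf
  -- The induction needs at least one level. With none, the length `π/3 < 3/2` of the phase range
  -- suffices.
  suffices hmain : ∀ i, (∀ j < i + 1, ∀ b,
      |Real.cos (levelMul j b * φ) - Real.cos (levelMul j b * ψ)| ≤ 1 / 16) →
      3 ^ i * d ≤ 1 / 4 by
    cases i with
    | zero =>
      have h1 := hφ.le_pi_div_three
      have h2 := hψ.le_pi_div_three
      rw [abs_le]
      constructor <;> linarith [hφ.1.1, hψ.1.1]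
    | succ i =>
      have := hmain i h
      have h3 : (0 : ℝ) < 3 ^ i := by positivity
      rw [pow_succ, one_div_pow, show |φ - ψ| = 2 * d by rw [hd]; ring]
      rw [show (3 : ℝ) / 2 * (1 / 3 ^ i * (1 / 3)) = (1 / 2) / 3 ^ i by ring, le_div_iff₀ h3]
      linarith
  intro i
  induction i with
  | zero =>
    intro h
    have hd6 : d ≤ Real.pi / 6 := by
      have h1 := hφ.le_pi_div_three
      have h2 := hψ.le_pi_div_three
      have : |φ - ψ| ≤ Real.pi / 3 := by
        rw [abs_le]
        constructor <;> linarith [hφ.1.1, hψ.1.1]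
      rw [hd]
      linarith
    have h1 := h 0 (by norm_num) false
    rw [show levelMul 0 false = 1 by simp [levelMul], hsum 1 zero_le_one (by linarith), one_mul,
      one_mul, abs_of_nonneg (by linarith [hmid.sin_ge])] at h1
    have h2 : 0 ≤ Real.sin d := Real.sin_nonneg_of_nonneg_of_le_pi hd0 (by linarith)
    rw [pow_zero, one_mul]
    refine le_quarter_of_sin_le hd0 (by linarith) ?_
    nlinarith [hmid.sin_ge]
  | succ i ih =>
    intro h
    have hi := ih fun j hj => h j (by omega)
    have h3 : (1 : ℝ) ≤ 3 ^ i := one_le_pow₀ (by norm_num)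
    set m : ℝ := 3 ^ (i + 1) with hm
    have hm3 : m = 3 * 3 ^ i := by rw [hm]; ring
    have hmd : m * d ≤ 3 / 4 := by rw [hm3]; linarith
    -- Here `3 · 3^i d ≤ 3/4` and `2d ≤ 1/2`; the sum `5/4` is still below `π/2`.
    have hmd2 : (m + 2) * d ≤ 5 / 4 := by nlinarith
    have e1 := h (i + 1) (by omega) false
    have e2 := h (i + 1) (by omega) true
    simp only [levelMul, if_true, Bool.false_eq_true, if_false, add_zero, ← hm] at e1 e2
    have hm0 : 0 ≤ m := by positivity
    rw [hsum m hm0 (by linarith)] at e1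
    rw [hsum (m + 2) (by linarith) (by linarith)] at e2
    have hmd0 : 0 ≤ m * d := by positivity
    have s1 : 0 ≤ Real.sin (m * d) := Real.sin_nonneg_of_nonneg_of_le_pi hmd0 (by linarith)
    have s2 : 0 ≤ Real.sin ((m + 2) * d) :=
      Real.sin_nonneg_of_nonneg_of_le_pi (by positivity) (by linarith)
    -- Since `2σ = (m+2)σ - mσ`, the addition formula bounds `sin 2σ` by the sum of the two sines.
    -- On the phase range `sin 2σ = 2 sin σ cos σ ≥ 2 · 3/5 · 1/2`.
    have hlarge : 3 / 5 ≤ |Real.sin (m * σ)| + |Real.sin ((m + 2) * σ)| := by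
      have h2 : Real.sin (2 * σ) = Real.sin ((m + 2) * σ) * Real.cos (m * σ) -
          Real.cos ((m + 2) * σ) * Real.sin (m * σ) := by
        rw [← Real.sin_sub]
        ring_nf
      have h2' : 3 / 5 ≤ Real.sin (2 * σ) := by
        rw [Real.sin_two_mul]
        nlinarith [hmid.sin_ge, hmid.2.1]
      have b1 : Real.sin ((m + 2) * σ) * Real.cos (m * σ) ≤ |Real.sin ((m + 2) * σ)| := by
        refine (le_abs_self _).trans ?_
        rw [abs_mul]
        exact mul_le_of_le_one_right (abs_nonneg _) (Real.abs_cos_le_one _)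
      have b2 : -(Real.cos ((m + 2) * σ) * Real.sin (m * σ)) ≤ |Real.sin (m * σ)| := by
        refine (neg_le_abs _).trans ?_
        rw [abs_mul]
        exact mul_le_of_le_one_left (abs_nonneg _) (Real.abs_cos_le_one _)
      linarith
    rcases le_or_gt (3 / 10) |Real.sin (m * σ)| with hc | hc
    · exact le_quarter_of_sin_le hmd0 (by linarith) (by nlinarith)
    · have : (m + 2) * d ≤ 1 / 4 :=
        le_quarter_of_sin_le (by positivity) (by linarith) (by nlinarith)
      linarith

/-- The phase explains the observed frequencies in the levels below `i`. -/
def Consistent (freq : ℕ → Bool → ℝ) (i : ℕ) (φ : ℝ) : Prop :=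
  ∀ j < i, ∀ b, |freq j b - levelProb φ j b| ≤ 1 / 64

/-- A phase that explains the observed frequencies in as many levels as possible. -/
theorem exists_phase (freq : ℕ → Bool → ℝ) (N : ℕ) : ∃ φ, PhaseRange φ ∧
    ∀ ψ, PhaseRange ψ → ∀ i ≤ N, Consistent freq i ψ → Consistent freq i φ := by
  induction N with
  | zero =>
    refine ⟨Real.arccos (1 / 2), ⟨⟨Real.arccos_nonneg _, Real.arccos_le_pi _⟩, ?_⟩, ?_⟩
    · rw [Real.cos_arccos (by norm_num) (by norm_num)]
      norm_num
    · rintro ψ - i hi -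
      obtain rfl : i = 0 := by omega
      exact fun j hj => absurd hj (by omega)
  | succ N ih =>
    by_cases h : ∃ ψ, PhaseRange ψ ∧ Consistent freq (N + 1) ψ
    · obtain ⟨φ, hφ, hc⟩ := h
      exact ⟨φ, hφ, fun ψ _ i hi _ j hj => hc j (by omega)⟩
    -- If no admissible phase explains all `N + 1` levels, a best phase for `N` levels is still
    -- best.
    · obtain ⟨φ, hφ, hc⟩ := ih
      refine ⟨φ, hφ, fun ψ hψ i hi hi' => ?_⟩
      rcases Nat.lt_or_ge N i with hlt | hge
      · obtain rfl : i = N + 1 := by omega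
        exact absurd ⟨ψ, hψ, hi'⟩ h
      · exact hc ψ hψ i hge hi'

/-- The estimate of the phase. -/
def phaseEstimate (N : ℕ) (freq : ℕ → Bool → ℝ) : ℝ := (exists_phase freq N).choose

/-- Let `j` be the first level with a bad frequency. The true phase explains the levels below `j`,
hence so does the estimate, and the error is at most `3/2 · 3^(-j)`. Summing over all bad levels
gives a bound whose expectation can be taken term by term. -/
theorem abs_phaseEstimate_sub_le (N : ℕ) (freq : ℕ → Bool → ℝ) {φ : ℝ} (hφ : PhaseRange φ) :
    |phaseEstimate N freq - φ| ≤ 3 / 2 * ((1 / 3) ^ N + ∑ j ∈ Finset.range N, ∑ b : Bool,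
      if 1 / 64 < |freq j b - levelProb φ j b| then (1 / 3) ^ j else 0) := by
  obtain ⟨hr, hc⟩ := (exists_phase freq N).choose_spec
  change PhaseRange (phaseEstimate N freq) at hr
  change ∀ ψ, PhaseRange ψ → ∀ i ≤ N, Consistent freq i ψ →
    Consistent freq i (phaseEstimate N freq) at hc
  set ψ := phaseEstimate N freq
  have hclose : ∀ i ≤ N, Consistent freq i φ → |ψ - φ| ≤ 3 / 2 * (1 / 3) ^ i := by
    intro i hi h
    refine abs_sub_le_of_cos_close hr hφ i fun j hj b => ?_
    have h1 := h j hj b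
    have h2 := hc φ hφ i hi h j hj b
    -- Two tolerances `1/64` allow a difference `1/32` of probabilities, that is `1/16` of cosines.
    rw [levelProb_eq, abs_le] at h1 h2
    rw [abs_le]
    constructor <;> linarith [h1.1, h1.2, h2.1, h2.2]
  have hnn : ∀ j, ∀ b : Bool, (0 : ℝ) ≤
      if 1 / 64 < |freq j b - levelProb φ j b| then (1 / 3) ^ j else 0 := by
    intro j b
    split_ifs <;> positivity
  by_cases hall : Consistent freq N φ
  · refine (hclose N le_rfl hall).trans (mul_le_mul_of_nonneg_left ?_ (by norm_num))
    exact le_add_of_nonneg_right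
      (Finset.sum_nonneg fun j _ => Finset.sum_nonneg fun b _ => hnn j b)
  · have hex : ∃ j, j < N ∧ ∃ b, 1 / 64 < |freq j b - levelProb φ j b| := by
      by_contra! hne
      exact hall fun j hj b => hne j hj b
    classical
    set j := Nat.find hex with hj
    obtain ⟨hjN, b, hb⟩ := Nat.find_spec hex
    have hcj : Consistent freq j φ := by
      intro i hi b
      by_contra! hlt
      exact Nat.find_min hex hi ⟨by omega, b, hlt⟩
    refine (hclose j hjN.le hcj).trans (mul_le_mul_of_nonneg_left ?_ (by norm_num))
    have h1 : (1 / 3 : ℝ) ^ j = if 1 / 64 < |freq j b - levelProb φ j b| then (1 / 3) ^ j else 0 := by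
      rw [if_pos hb]
    have h2 := Finset.single_le_sum (f := fun b : Bool =>
      if 1 / 64 < |freq j b - levelProb φ j b| then (1 / 3 : ℝ) ^ j else 0)
      (fun b _ => hnn j b) (Finset.mem_univ b)
    have h3 := Finset.single_le_sum (f := fun j => ∑ b : Bool,
      if 1 / 64 < |freq j b - levelProb φ j b| then (1 / 3 : ℝ) ^ j else 0)
      (fun j _ => Finset.sum_nonneg fun b _ => hnn j b) (Finset.mem_range.2 hjN)
    have h4 : (0 : ℝ) ≤ (1 / 3) ^ N := by positivity
    linarith

/-! Independent runs. -/

/-- The expectation of `F` when the outcomes of the runs are independent with weights `w r`. -/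
def expect {R O : Type*} [Fintype R] [DecidableEq R] [Fintype O] (w : R → O → ℝ)
    (F : (R → O) → ℝ) : ℝ :=
  ∑ o : R → O, F o * ∏ r, w r (o r)

section Expect

variable {R O : Type*} [Fintype R] [DecidableEq R] [Fintype O] {w : R → O → ℝ}

theorem expect_mono (hw : ∀ r x, 0 ≤ w r x) {F G : (R → O) → ℝ} (h : ∀ o, F o ≤ G o) :
    expect w F ≤ expect w G :=
  Finset.sum_le_sum fun o _ => mul_le_mul_of_nonneg_right (h o)
    (Finset.prod_nonneg fun r _ => hw r _)

theorem expect_add (F G : (R → O) → ℝ) :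
    expect w (fun o => F o + G o) = expect w F + expect w G := by
  simp only [expect, add_mul, Finset.sum_add_distrib]

theorem expect_const_mul (a : ℝ) (F : (R → O) → ℝ) :
    expect w (fun o => a * F o) = a * expect w F := by
  simp only [expect, mul_assoc, Finset.mul_sum]

theorem expect_sum {κ : Type*} (s : Finset κ) (F : κ → (R → O) → ℝ) :
    expect w (fun o => ∑ k ∈ s, F k o) = ∑ k ∈ s, expect w (F k) := by
  simp only [expect, Finset.sum_mul]
  exact Finset.sum_comm

theorem expect_prod (h : R → O → ℝ) :
    expect w (fun o => ∏ r, h r (o r)) = ∏ r, ∑ x, h r x * w r x := by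
  simp only [expect, ← Finset.prod_mul_distrib]
  rw [Finset.prod_univ_sum, Fintype.piFinset_univ]

theorem expect_const (hw1 : ∀ r, ∑ x, w r x = 1) (a : ℝ) : expect w (fun _ => a) = a := by
  have := expect_prod (w := w) fun _ _ => 1
  simp only [Finset.prod_const_one, one_mul, hw1] at this
  have h := expect_const_mul (w := w) a fun _ => 1
  simpa [this] using h

theorem exp_le_one_add_add_sq {x : ℝ} (h : |x| ≤ 1) : Real.exp x ≤ 1 + x + x ^ 2 := by
  have := (abs_le.1 (Real.abs_exp_sub_one_sub_id_le h)).2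
  linarith

/-- The exponential moment of the deviation of a frequency. -/
theorem expect_exp_le (hw : ∀ r x, 0 ≤ w r x) (hw1 : ∀ r, ∑ x, w r x = 1) (G : Finset R)
    (B : O → Bool) {q t : ℝ} (hq : ∀ r ∈ G, ∑ x, (if B x then w r x else 0) = q) (ht : |t| ≤ 1) :
    expect w (fun o => Real.exp (t * ∑ r ∈ G, ((if B (o r) then 1 else 0) - q))) ≤
      Real.exp (t ^ 2 * G.card) := by
  classical
  have h1 : ∀ o : R → O, Real.exp (t * ∑ r ∈ G, ((if B (o r) then 1 else 0) - q)) =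
      ∏ r, if r ∈ G then Real.exp (t * ((if B (o r) then 1 else 0) - q)) else 1 := by
    intro o
    rw [Finset.prod_ite_mem, Finset.univ_inter, Finset.mul_sum, Real.exp_sum]
  simp only [h1]
  rw [expect_prod fun r x => if r ∈ G then Real.exp (t * ((if B x then 1 else 0) - q)) else 1]
  have h2 : ∀ r, (∑ x, (if r ∈ G then Real.exp (t * ((if B x then 1 else 0) - q)) else 1) * w r x) ≤
      if r ∈ G then Real.exp (t ^ 2) else 1 := by
    intro r
    split_ifs with hr
    · have hqr := hq r hr
      have q0 : 0 ≤ q := by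
        rw [← hqr]
        exact Finset.sum_nonneg fun x _ => by split_ifs <;> simp [hw]
      have q1 : q ≤ 1 := by
        rw [← hqr, ← hw1 r]
        exact Finset.sum_le_sum fun x _ => by split_ifs <;> simp [hw]
      -- From `exp y ≤ 1 + y + y²`. The linear term has mean zero, so after summation `1 + t² ≤
      -- exp(t²)` remains.
      have h3 : ∀ x, Real.exp (t * ((if B x then 1 else 0) - q)) * w r x ≤
          t * (if B x then w r x else 0) + (1 - t * q + t ^ 2) * w r x := by
        intro x
        have hy : |(if B x then (1 : ℝ) else 0) - q| ≤ 1 := by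
          split_ifs <;> rw [abs_le] <;> constructor <;> linarith
        have hty : |t * ((if B x then (1 : ℝ) else 0) - q)| ≤ 1 := by
          rw [abs_mul]
          exact mul_le_one₀ ht (abs_nonneg _) hy
        have h4 := exp_le_one_add_add_sq hty
        have h5 : (t * ((if B x then (1 : ℝ) else 0) - q)) ^ 2 ≤ t ^ 2 := by
          rw [mul_pow]
          have := (sq_le_one_iff_abs_le_one _).2 hy
          nlinarith [sq_nonneg t]
        calc _ ≤ (1 + t * ((if B x then (1 : ℝ) else 0) - q) + t ^ 2) * w r x :=
              mul_le_mul_of_nonneg_right (by linarith) (hw r x)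
          _ = _ := by split_ifs <;> ring
      refine (Finset.sum_le_sum fun x _ => h3 x).trans ?_
      rw [Finset.sum_add_distrib, ← Finset.mul_sum, ← Finset.mul_sum, hqr, hw1]
      linarith [Real.add_one_le_exp (t ^ 2)]
    · simp [hw1]
  calc _ ≤ ∏ r, (if r ∈ G then Real.exp (t ^ 2) else 1) :=
        Finset.prod_le_prod (fun r _ => Finset.sum_nonneg fun x _ => mul_nonneg (by
          split_ifs <;> positivity) (hw r x)) fun r _ => h2 r
    _ = _ := by
        rw [Finset.prod_ite_mem, Finset.univ_inter, Finset.prod_const, ← Real.exp_nat_mul, mul_comm]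

/-- Chernoff's bound with `t = ±η/2` gives `2 exp(-η² M/4)`. Inverse quadratic decay in the number
`M` of runs is all that is needed, and `exp y ≥ y²/2` provides it. -/
theorem expect_deviation_le (hw : ∀ r x, 0 ≤ w r x) (hw1 : ∀ r, ∑ x, w r x = 1) {G : Finset R}
    (B : O → Bool) {q η : ℝ} (hq : ∀ r ∈ G, ∑ x, (if B x then w r x else 0) = q) (hη : 0 < η)
    (hη2 : η ≤ 2) (hG : 0 < G.card) :
    expect w (fun o => if η < |(∑ r ∈ G, if B (o r) then 1 else 0) / (G.card : ℝ) - q|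
      then 1 else 0) ≤ 64 / (η ^ 4 * (G.card : ℝ) ^ 2) := by
  set M : ℝ := (G.card : ℝ) with hM
  have hM0 : 0 < M := by positivity
  set S : (R → O) → ℝ := fun o => ∑ r ∈ G, ((if B (o r) then 1 else 0) - q) with hS
  have hSeq : ∀ o, (∑ r ∈ G, if B (o r) then (1 : ℝ) else 0) / M - q = S o / M := by
    intro o
    rw [hS]
    simp only [Finset.sum_sub_distrib, Finset.sum_const, nsmul_eq_mul, ← hM]
    field_simp
  have habs : |η / 2| ≤ 1 := by rw [abs_of_pos (by positivity)]; linarith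
  have e1 := expect_exp_le hw hw1 G B hq habs
  have e2 := expect_exp_le hw hw1 G B (t := -(η / 2)) hq (by rwa [abs_neg])
  have hpt : ∀ o, (if η < |(∑ r ∈ G, if B (o r) then (1 : ℝ) else 0) / M - q| then (1 : ℝ) else 0) ≤
      Real.exp (-(η ^ 2 * M / 2)) * (Real.exp (η / 2 * S o) + Real.exp (-(η / 2) * S o)) := by
    intro o
    split_ifs with h
    · rw [hSeq, abs_div, abs_of_pos hM0, lt_div_iff₀ hM0] at h
      rw [mul_add, ← Real.exp_add, ← Real.exp_add]
      rcases abs_cases (S o) with ⟨h1, -⟩ | ⟨h1, -⟩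
      · have : 1 ≤ Real.exp (-(η ^ 2 * M / 2) + η / 2 * S o) := by
          rw [Real.one_le_exp_iff]
          nlinarith
        linarith [Real.exp_pos (-(η ^ 2 * M / 2) + -(η / 2) * S o)]
      · have : 1 ≤ Real.exp (-(η ^ 2 * M / 2) + -(η / 2) * S o) := by
          rw [Real.one_le_exp_iff]
          nlinarith
        linarith [Real.exp_pos (-(η ^ 2 * M / 2) + η / 2 * S o)]
    · positivity
  refine (expect_mono hw hpt).trans ?_
  rw [expect_const_mul, expect_add]
  have hexp : Real.exp (-(η ^ 2 * M / 2)) * Real.exp ((η / 2) ^ 2 * M) =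
      (Real.exp (η ^ 2 * M / 4))⁻¹ := by
    rw [← Real.exp_add, ← Real.exp_neg]
    congr 1
    ring
  have hlow : (η ^ 2 * M / 4) ^ 2 / 2 ≤ Real.exp (η ^ 2 * M / 4) := by
    have := Real.quadratic_le_exp_of_nonneg (show 0 ≤ η ^ 2 * M / 4 by positivity)
    have h0 : 0 ≤ η ^ 2 * M / 4 := by positivity
    linarith
  have hpos : 0 < (η ^ 2 * M / 4) ^ 2 / 2 := by positivity
  have hinv := inv_anti₀ hpos hlow
  rw [neg_sq] at e2
  calc _ ≤ Real.exp (-(η ^ 2 * M / 2)) * (Real.exp ((η / 2) ^ 2 * M) + Real.exp ((η / 2) ^ 2 * M)) :=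
        mul_le_mul_of_nonneg_left (add_le_add e1 e2) (Real.exp_pos _).le
    _ = 2 * (Real.exp (η ^ 2 * M / 4))⁻¹ := by rw [← hexp]; ring
    _ ≤ 2 * ((η ^ 2 * M / 4) ^ 2 / 2)⁻¹ := by linarith
    _ = _ := by field_simp; norm_num

/-- The expected error of the phase estimate, when the circuits of the level `j` are run
`2 ^ (N - j)` times. -/
theorem expect_phaseEstimate_le (hw : ∀ r x, 0 ≤ w r x) (hw1 : ∀ r, ∑ x, w r x = 1) (N : ℕ)
    (G : ℕ → Bool → Finset R) (B : O → Bool) {φ : ℝ} (hφ : PhaseRange φ)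
    (hG : ∀ j < N, ∀ b, (G j b).card = 2 ^ (N - j))
    (hq : ∀ j < N, ∀ b, ∀ r ∈ G j b, ∑ x, (if B x then w r x else 0) = levelProb φ j b) :
    expect w (fun o => |phaseEstimate N (fun j b =>
      (∑ r ∈ G j b, if B (o r) then 1 else 0) / ((G j b).card : ℝ)) - φ|) ≤
      10 * 64 ^ 5 * (1 / 3) ^ N := by
  refine (expect_mono hw fun o => abs_phaseEstimate_sub_le N _ hφ).trans ?_
  rw [expect_const_mul, expect_add, expect_const hw1, expect_sum]
  -- With `η = 1/64` and `2^(N-j)` runs a failure has probability at most `64^5 · 4^(-(N-j))`.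
  -- Multiplied by `3^(-j)`, this is `64^5 · 3^(-N) (3/4)^(N-j)`, summable in `j`.
  have hterm : ∀ j ∈ Finset.range N, expect w (fun o => ∑ b : Bool,
      if 1 / 64 < |(∑ r ∈ G j b, if B (o r) then 1 else 0) / ((G j b).card : ℝ) -
        levelProb φ j b| then (1 / 3) ^ j else 0) ≤
      2 * 64 ^ 5 * (1 / 3) ^ N * (3 / 4) ^ (N - j) := by
    intro j hj
    rw [Finset.mem_range] at hj
    rw [expect_sum]
    have hb : ∀ b : Bool, expect w (fun o =>
        if 1 / 64 < |(∑ r ∈ G j b, if B (o r) then 1 else 0) / ((G j b).card : ℝ) -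
        levelProb φ j b| then (1 / 3) ^ j else 0) ≤ 64 ^ 5 * (1 / 3) ^ N * (3 / 4) ^ (N - j) := by
      intro b
      have h1 := expect_deviation_le hw hw1 B (G := G j b) (hq j hj b)
        (show (0 : ℝ) < 1 / 64 by norm_num) (by norm_num) (by rw [hG j hj]; positivity)
      have h2 : ∀ o : R → O, (if 1 / 64 < |(∑ r ∈ G j b, if B (o r) then 1 else 0) /
          ((G j b).card : ℝ) - levelProb φ j b| then (1 / 3 : ℝ) ^ j else 0) =
          (1 / 3) ^ j * if 1 / 64 < |(∑ r ∈ G j b, if B (o r) then 1 else 0) /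
          ((G j b).card : ℝ) - levelProb φ j b| then 1 else 0 := by
        intro o
        split_ifs <;> simp
      simp only [h2]
      rw [expect_const_mul]
      refine (mul_le_mul_of_nonneg_left h1 (by positivity)).trans (le_of_eq ?_)
      obtain ⟨k, rfl⟩ := Nat.exists_eq_add_of_lt hj
      have e : (1 / 3 : ℝ) ^ (k + 1) * (3 / 4) ^ (k + 1) = (((2 : ℝ) ^ (k + 1)) ^ 2)⁻¹ := by
        rw [← mul_pow, ← pow_mul, mul_comm (k + 1) 2, pow_mul, ← inv_pow]
        norm_num
      rw [hG j (by omega), show j + k + 1 - j = k + 1 by omega,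
        show j + k + 1 = j + (k + 1) by omega, pow_add (1 / 3 : ℝ) j (k + 1), Nat.cast_pow,
        Nat.cast_ofNat, ← mul_assoc, mul_assoc _ ((1 / 3 : ℝ) ^ (k + 1)), e]
      field_simp
    refine (Finset.sum_le_sum fun b _ => hb b).trans (le_of_eq ?_)
    rw [Fintype.sum_bool]
    ring
  have hgeo : ∑ j ∈ Finset.range N, (3 / 4 : ℝ) ^ (N - j) ≤ 3 := by
    have : ∑ j ∈ Finset.range N, (3 / 4 : ℝ) ^ (N - j) = 3 - 3 * (3 / 4) ^ N := by
      clear hterm hG hq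
      induction N with
      | zero => simp
      | succ N ih =>
        rw [Finset.sum_range_succ', Finset.sum_congr rfl fun j _ => by
          rw [Nat.add_sub_add_right], ih, Nat.sub_zero, pow_succ]
        ring
    rw [this]
    have : (0 : ℝ) ≤ (3 / 4) ^ N := by positivity
    linarith
  have hsum := Finset.sum_le_sum hterm
  rw [← Finset.mul_sum] at hsum
  have h0 : (0 : ℝ) ≤ (1 / 3) ^ N := by positivity
  have h1 := mul_le_mul_of_nonneg_left hgeo (show (0 : ℝ) ≤ 2 * 64 ^ 5 * (1 / 3) ^ N by positivity)
  -- The total factor is `3/2 · (1 + 6 · 64^5) ≤ 10 · 64^5`.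
  linarith

end Expect

/-! The integral of a piecewise constant path. -/

namespace HoldingTimeRep

variable {Ω : Type*} [MeasurableSpace Ω] {μ : MeasureTheory.Measure Ω} {X : ℝ → Ω → ℝ}
  {n lx lτ : ℕ} {wt : Fin lx → ℝ}

theorem _root_.QCTSP.cumTime_succ {n : ℕ} (τ : Fin n → ℕ) (j : Fin n) :
    cumTime τ (j + 1) = cumTime τ j + τ j := by
  have h : ∀ i : Fin n, (if (i : ℕ) < j + 1 then τ i else 0) =
      (if (i : ℕ) < j then τ i else 0) + if i = j then τ i else 0 := by
    intro i
    rcases lt_trichotomy (i : ℕ) j with h | h | h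
    · simp [h, h.trans (Nat.lt_succ_self _), Fin.ne_of_lt h]
    · simp [Fin.ext h]
    · have h1 : ¬ (i : ℕ) < j + 1 := by omega
      have h2 : ¬ (i : ℕ) < j := by omega
      simp [h1, h2, Fin.ne_of_gt h]
  simp only [cumTime, h, Finset.sum_add_distrib]
  simp

/-- The value of the path integral for given encodings. -/
def _root_.QCTSP.bitIntegral (wt : Fin lx → ℝ) (xb : Fin n → Fin lx → Bool)
    (tb : Fin n → Fin lτ → Bool) : ℝ :=
  ∑ j, bitValue wt (xb j) * bitNat (tb j)

/-- The interval is cut at the times `T_k`. The path is constant in the interior of each piece, and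
endpoints do not affect the integral. -/
theorem ae_pathIntegral (R : HoldingTimeRep μ X n lx lτ wt) :
    ∀ᵐ ω ∂μ, R.pathIntegral ω = ∑ j, R.value j ω * R.hold j ω := by
  filter_upwards [R.path_eq] with ω hω
  set τ : Fin n → ℕ := fun i => bitNat (R.holdBits ω i) with hτ
  set v : ℕ → ℝ := fun k => if h : k < n then bitValue wt (R.valueBits ω ⟨k, h⟩) else 0 with hv
  have hmono : ∀ k < n, (cumTime τ k : ℝ) ≤ cumTime τ (k + 1) := by
    intro k hk
    rw [cumTime_succ τ ⟨k, hk⟩]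
    push_cast
    linarith [(Nat.cast_nonneg (τ ⟨k, hk⟩) : (0 : ℝ) ≤ _)]
  have heq : ∀ k < n, ∀ t ∈ Set.Ioo (cumTime τ k : ℝ) (cumTime τ (k + 1)), X t ω = v k := by
    intro k hk t ht
    rw [hω ⟨k, hk⟩ t ht.1.le ht.2, hv]
    simp only [hk, dite_true]
  have hint : ∀ k < n, IntervalIntegrable (fun t => X t ω) MeasureTheory.volume
      (cumTime τ k : ℝ) (cumTime τ (k + 1)) := by
    intro k hk
    refine (intervalIntegrable_const (c := v k)).congr_uIoo ?_
    rw [Set.uIoo_of_le (hmono k hk)]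
    exact fun t ht => (heq k hk t ht).symm
  have hsum := intervalIntegral.sum_integral_adjacent_intervals
    (a := fun k => (cumTime τ k : ℝ)) hint
  have hend : cumTime τ n = R.endTime ω := by
    simp only [cumTime, endTime, Fin.is_lt, if_true]
    rfl
  have hzero : cumTime τ 0 = 0 := by simp [cumTime]
  simp only [hend, hzero, Nat.cast_zero] at hsum
  rw [pathIntegral, ← hsum, Finset.sum_range]
  refine Finset.sum_congr rfl fun j _ => ?_
  rw [intervalIntegral.integral_congr_Ioo_of_le (hmono j j.2) (g := fun _ => v j) (heq j j.2),
    intervalIntegral.integral_const, cumTime_succ]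
  have : v j = R.value j ω := by simp [hv, value]
  rw [this, hold]
  push_cast
  rw [smul_eq_mul, hτ]
  ring

theorem ae_pathIntegral_bits (R : HoldingTimeRep μ X n lx lτ wt) :
    ∀ᵐ ω ∂μ, R.pathIntegral ω = bitIntegral wt (R.valueBits ω) (R.holdBits ω) :=
  R.ae_pathIntegral

variable [MeasureTheory.IsProbabilityMeasure μ]

theorem integrable_bits (R : HoldingTimeRep μ X n lx lτ wt)
    (G : (Fin n → Fin lx → Bool) → (Fin n → Fin lτ → Bool) → ℝ) :
    MeasureTheory.Integrable (fun ω => G (R.valueBits ω) (R.holdBits ω)) μ := by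
  have hm : Measurable fun ω => (R.valueBits ω, R.holdBits ω) :=
    R.measurable_valueBits.prodMk R.measurable_holdBits
  have hG : Measurable fun p : (Fin n → Fin lx → Bool) × (Fin n → Fin lτ → Bool) => G p.1 p.2 :=
    Measurable.of_discrete
  obtain ⟨b, hb⟩ := (Set.finite_range fun p : (Fin n → Fin lx → Bool) × (Fin n → Fin lτ → Bool) =>
    ‖G p.1 p.2‖).bddAbove
  exact MeasureTheory.Integrable.of_bound (hG.comp hm).aestronglyMeasurable b
    (Filter.Eventually.of_forall fun ω => hb ⟨(R.valueBits ω, R.holdBits ω), rfl⟩)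

theorem integral_bits (R : HoldingTimeRep μ X n lx lτ wt)
    (G : (Fin n → Fin lx → Bool) → (Fin n → Fin lτ → Bool) → ℝ) :
    ∫ ω, G (R.valueBits ω) (R.holdBits ω) ∂μ =
      ∑ xb, ∑ tb, G xb tb * μ.real {ω | R.valueBits ω = xb ∧ R.holdBits ω = tb} := by
  have hm : Measurable fun ω => (R.valueBits ω, R.holdBits ω) :=
    R.measurable_valueBits.prodMk R.measurable_holdBits
  have hG : Measurable fun p : (Fin n → Fin lx → Bool) × (Fin n → Fin lτ → Bool) => G p.1 p.2 :=
    Measurable.of_discrete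
  have h := MeasureTheory.integral_map hm.aemeasurable (μ := μ) hG.aestronglyMeasurable
  rw [← h, MeasureTheory.integral_fintype, Fintype.sum_prod_type]
  · refine Finset.sum_congr rfl fun xb _ => Finset.sum_congr rfl fun tb _ => ?_
    rw [MeasureTheory.map_measureReal_apply hm (measurableSet_singleton _), smul_eq_mul, mul_comm]
    congr 2
    ext ω
    simp
  · exact (MeasureTheory.integrable_map_measure hG.aestronglyMeasurable hm.aemeasurable).2
      (R.integrable_bits G)

/-- Almost surely the path integral is a function of finitely many random bits, so `g` need not be
measurable or bounded. -/
theorem integrable_comp_pathIntegral (R : HoldingTimeRep μ X n lx lτ wt) (g : ℝ → ℝ) :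
    MeasureTheory.Integrable (fun ω => g (R.pathIntegral ω)) μ :=
  (R.integrable_bits fun xb tb => g (bitIntegral wt xb tb)).congr
    (R.ae_pathIntegral_bits.mono fun ω h => by simp only [h])

theorem integral_comp_pathIntegral (R : HoldingTimeRep μ X n lx lτ wt) (g : ℝ → ℝ) :
    ∫ ω, g (R.pathIntegral ω) ∂μ = ∑ xb, ∑ tb, g (bitIntegral wt xb tb) *
      μ.real {ω | R.valueBits ω = xb ∧ R.holdBits ω = tb} := by
  rw [← R.integral_bits fun xb tb => g (bitIntegral wt xb tb)]
  exact MeasureTheory.integral_congr_ae (R.ae_pathIntegral_bits.mono fun ω h => by simp only [h])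

end HoldingTimeRep

/-! Fourier coefficients. -/

section Fourier

variable (f : ℝ → ℝ) (a : ℝ) {P : ℝ} (hP : 0 < P)

theorem coeff_eq (l : ℤ) : coeff f a hP l =
    (1 / P) • ∫ x in a..(a + P), Complex.exp (-(2 * Real.pi * Complex.I * l / P) * x) * f x := by
  rw [coeff, fourierCoeffOn_eq_integral, add_sub_cancel_left]
  congr 1
  refine intervalIntegral.integral_congr fun x _ => ?_
  simp only [fourier_coe_apply, smul_eq_mul]
  congr 2
  push_cast
  ring

theorem coeff_neg (l : ℤ) : coeff f a hP (-l) = (starRingEnd ℂ) (coeff f a hP l) := by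
  rw [coeff_eq, coeff_eq, Complex.real_smul, Complex.real_smul, map_mul, Complex.conj_ofReal,
    ← intervalIntegral.intervalIntegral_conj]
  congr 1
  refine intervalIntegral.integral_congr fun x _ => ?_
  simp only [map_mul, ← Complex.exp_conj, Complex.conj_ofReal]
  congr 2
  simp only [map_neg, map_mul, map_div₀, Complex.conj_ofReal, Complex.conj_I, map_ofNat,
    map_intCast]
  push_cast
  ring

/-- The weight of the cosine or sine of frequency `l` in the Fourier approximation. -/
def termWeight (l : ℕ) (s : Part) : ℝ :=
  match s with
  | .cosine => 2 * (coeff f a hP l).re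
  | .sine => -2 * (coeff f a hP l).im

theorem abs_termWeight_le (l : ℕ) (s : Part) : |termWeight f a hP l s| ≤ 2 * ‖coeff f a hP l‖ := by
  cases s
  · rw [termWeight, abs_mul, abs_two]
    linarith [Complex.abs_re_le_norm (coeff f a hP l)]
  · rw [termWeight, abs_mul, abs_neg, abs_two]
    linarith [Complex.abs_im_le_norm (coeff f a hP l)]

/-- As `f` is real, `c_{-l}` is the conjugate of `c_l`, and the terms `±l` combine to `2 Re(c_l
exp(iy))`. Thus only positive frequencies have to be estimated. -/
theorem fourierApprox_eq (L : ℕ) (x : ℝ) : fourierApprox f a hP L x = (coeff f a hP 0).re +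
    ∑ l ∈ Finset.range L, (termWeight f a hP (l + 1) .cosine *
        Part.eval .cosine (2 * Real.pi * (l + 1 : ℕ) / P * x) +
      termWeight f a hP (l + 1) .sine * Part.eval .sine (2 * Real.pi * (l + 1 : ℕ) / P * x)) := by
  induction L with
  | zero => simp [fourierApprox]
  | succ L ih =>
    have hI : Finset.Icc (-((L + 1 : ℕ) : ℤ)) (L + 1 : ℕ) =
        insert (-((L + 1 : ℕ) : ℤ)) (insert ((L + 1 : ℕ) : ℤ) (Finset.Icc (-(L : ℤ)) L)) := by
      ext k
      simp only [Finset.mem_insert, Finset.mem_Icc]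
      omega
    rw [Finset.sum_range_succ, ← add_assoc, ← ih, fourierApprox, fourierApprox, hI,
      Finset.sum_insert (by simp only [Finset.mem_insert, Finset.mem_Icc]; omega),
      Finset.sum_insert (by simp only [Finset.mem_Icc]; omega), coeff_neg]
    set c := coeff f a hP ((L + 1 : ℕ) : ℤ) with hc
    set y : ℝ := 2 * Real.pi * (L + 1 : ℕ) / P * x with hy
    have e1 : Complex.exp (2 * Real.pi * Complex.I * ((L + 1 : ℕ) : ℤ) * x / P) =
        Complex.exp (y * Complex.I) := by
      congr 1
      rw [hy]
      push_cast
      ring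
    have e2 : Complex.exp (2 * Real.pi * Complex.I * (-((L + 1 : ℕ) : ℤ) : ℤ) * x / P) =
        (starRingEnd ℂ) (Complex.exp (y * Complex.I)) := by
      rw [← Complex.exp_conj, map_mul, Complex.conj_ofReal, Complex.conj_I]
      congr 1
      rw [hy]
      push_cast
      ring
    have hre : (c * Complex.exp (y * Complex.I)).re =
        c.re * Real.cos y - c.im * Real.sin y := by
      rw [Complex.mul_re, Complex.exp_ofReal_mul_I_re, Complex.exp_ofReal_mul_I_im]
    rw [e1, e2, ← map_mul, Complex.add_re, Complex.add_re, Complex.conj_re, hre]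
    simp only [termWeight, Part.eval, ← hc]
    ring

include hP in
theorem integral_exp_period {l : ℕ} (hl : 1 ≤ l) (t : ℝ) :
    ∫ x in t..(t + P / l), Complex.exp (-(2 * Real.pi * Complex.I * l / P) * x) = 0 := by
  have hl0 : (l : ℂ) ≠ 0 := by exact_mod_cast (by omega : l ≠ 0)
  have hP0 : (P : ℂ) ≠ 0 := by exact_mod_cast hP.ne'
  have hc : -(2 * Real.pi * Complex.I * l / P : ℂ) ≠ 0 := by
    have := Real.pi_ne_zero
    have hpi : (Real.pi : ℂ) ≠ 0 := by exact_mod_cast this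
    simp [hl0, hP0, hpi, Complex.I_ne_zero]
  rw [integral_exp_mul_complex hc]
  have : -(2 * Real.pi * Complex.I * l / P : ℂ) * ((t + P / l : ℝ) : ℂ) =
      -(2 * Real.pi * Complex.I * l / P : ℂ) * t - 2 * Real.pi * Complex.I := by
    push_cast
    field_simp
    ring
  rw [this, Complex.exp_periodic.sub_eq, sub_self, zero_div]

theorem intervalIntegrable_of_eVariationOn {f : ℝ → ℝ} {a b : ℝ} (hab : a ≤ b)
    (h : eVariationOn f (Set.Icc a b) ≠ ⊤) :
    IntervalIntegrable f MeasureTheory.volume a b := by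
  obtain ⟨p, q, hp, hq, rfl⟩ := (BoundedVariationOn.locallyBoundedVariationOn
    (f := f) (s := Set.Icc a b) h).exists_monotoneOn_sub_monotoneOn
  rw [← Set.uIcc_of_le hab] at hp hq
  exact hp.intervalIntegrable.sub hq.intervalIntegrable

-- On each of the `l` periods of the exponential in the window, subtracting the value of `f` at the
-- left end does not change the integral. The integrand is then bounded by the variation of `f` on
-- that period, and the variations of adjacent periods add up.
include hP in
theorem mul_norm_coeff_le {f : ℝ → ℝ} {a V : ℝ} (hV : 0 ≤ V)
    (h : eVariationOn f (Set.Icc a (a + P)) ≤ ENNReal.ofReal V) {l : ℕ} (hl : 1 ≤ l) :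
    l * ‖coeff f a hP l‖ ≤ V := by
  have hfin : eVariationOn f (Set.Icc a (a + P)) ≠ ⊤ := ne_top_of_le_ne_top ENNReal.ofReal_ne_top h
  have hf := intervalIntegrable_of_eVariationOn (by linarith) hfin
  have hl0 : (0 : ℝ) < l := by exact_mod_cast hl
  set c : ℂ := -(2 * Real.pi * Complex.I * l / P) with hc
  set u : ℕ → ℝ := fun k => a + k * (P / l) with hu
  have hstep : 0 < P / l := by positivity
  have humono : Monotone u := fun i j hij => by
    have : (i : ℝ) ≤ j := by exact_mod_cast hij
    simp only [hu]
    nlinarith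
  have hu0 : u 0 = a := by simp [hu]
  have hul : u l = a + P := by simp only [hu]; field_simp
  have husucc : ∀ k, u (k + 1) = u k + P / l := by intro k; simp only [hu]; push_cast; ring
  have hsub : ∀ k < l, Set.Icc (u k) (u (k + 1)) ⊆ Set.Icc a (a + P) := by
    intro k hk
    exact Set.Icc_subset_Icc (hu0.symm.trans_le (humono (Nat.zero_le k)))
      ((humono (show k + 1 ≤ l from hk)).trans_eq hul)
  have hexp : Continuous fun x : ℝ => Complex.exp (c * x) := by fun_prop
  have hfk : ∀ k < l, IntervalIntegrable (fun x => (f x : ℂ)) MeasureTheory.volume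
      (u k) (u (k + 1)) := by
    intro k hk
    have hfk : IntervalIntegrable f MeasureTheory.volume (u k) (u (k + 1)) := by
      refine hf.mono_set ?_
      rw [Set.uIcc_of_le (humono (Nat.le_succ k)), Set.uIcc_of_le (by linarith)]
      exact hsub k hk
    exact ⟨hfk.1.ofReal, hfk.2.ofReal⟩
  have hfke : ∀ k < l, IntervalIntegrable (fun x => Complex.exp (c * x) * (f x : ℂ))
      MeasureTheory.volume (u k) (u (k + 1)) := fun k hk =>
    (hfk k hk).continuousOn_mul hexp.continuousOn
  have hvar : ∀ k < l, eVariationOn f (Set.Icc (u k) (u (k + 1))) ≠ ⊤ := fun k hk =>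
    ne_top_of_le_ne_top hfin (eVariationOn.mono f (hsub k hk))
  have hpiece : ∀ k < l, ‖∫ x in (u k)..(u (k + 1)), Complex.exp (c * x) * f x‖ ≤
      (eVariationOn f (Set.Icc (u k) (u (k + 1)))).toReal * (P / l) := by
    intro k hk
    have h0 : ∫ x in (u k)..(u (k + 1)), Complex.exp (c * x) * (f (u k) : ℂ) = 0 := by
      rw [intervalIntegral.integral_mul_const, husucc, integral_exp_period hP hl, zero_mul]
    have hi0 : IntervalIntegrable (fun x : ℝ => Complex.exp (c * x) * (f (u k) : ℂ))
        MeasureTheory.volume (u k) (u (k + 1)) :=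
      (hexp.mul continuous_const).intervalIntegrable _ _
    rw [← sub_zero (∫ x in (u k)..(u (k + 1)), Complex.exp (c * x) * (f x : ℂ)), ← h0,
      ← intervalIntegral.integral_sub (hfke k hk) hi0]
    have hb := intervalIntegral.norm_integral_le_of_norm_le_const (a := u k) (b := u (k + 1))
      (f := fun x => Complex.exp (c * x) * (f x : ℂ) - Complex.exp (c * x) * (f (u k) : ℂ))
      (C := (eVariationOn f (Set.Icc (u k) (u (k + 1)))).toReal) ?_
    · rwa [husucc, add_sub_cancel_left, abs_of_pos hstep, ← husucc] at hb
    · intro x hx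
      rw [Set.uIoc_of_le (humono (Nat.le_succ k))] at hx
      have hn : ‖Complex.exp (c * x)‖ = 1 := by
        rw [show c * x = ((-(2 * Real.pi * l / P * x) : ℝ) : ℂ) * Complex.I by
          rw [hc]; push_cast; ring, Complex.norm_exp_ofReal_mul_I]
      rw [← mul_sub, norm_mul, hn, one_mul, ← Complex.ofReal_sub, Complex.norm_real,
        ← dist_eq_norm]
      exact BoundedVariationOn.dist_le (hvar k hk) ⟨hx.1.le, hx.2⟩
        ⟨le_rfl, humono (Nat.le_succ k)⟩
  have hsum := intervalIntegral.sum_integral_adjacent_intervals hfke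
  rw [hu0, hul] at hsum
  have hVsum : ∑ k ∈ Finset.range l, (eVariationOn f (Set.Icc (u k) (u (k + 1)))).toReal ≤ V := by
    rw [← ENNReal.toReal_sum fun k hk => hvar k (Finset.mem_range.1 hk),
      eVariationOn.sum' f humono, hu0, hul]
    exact ENNReal.toReal_le_of_le_ofReal hV h
  have hnorm : ‖∫ x in a..(a + P), Complex.exp (c * x) * f x‖ ≤ V * (P / l) := by
    rw [← hsum]
    refine (norm_sum_le _ _).trans ((Finset.sum_le_sum fun k hk =>
      hpiece k (Finset.mem_range.1 hk)).trans ?_)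
    rw [← Finset.sum_mul]
    exact mul_le_mul_of_nonneg_right hVsum hstep.le
  have hce := coeff_eq f a hP l
  push_cast at hce
  rw [hce, norm_smul, Real.norm_of_nonneg (by positivity)]
  calc (l : ℝ) * (1 / P * ‖∫ x in a..(a + P), Complex.exp (c * x) * f x‖)
      ≤ l * (1 / P * (V * (P / l))) := by gcongr
    _ = V := by field_simp

end Fourier

/-! The evaluation circuits. -/

section Evaluation

variable {n lx lτ w : ℕ}

/-- The initial angle of the target qubit. -/
def Part.angle : Part → ℝ
  | .cosine => Real.pi / 2
  | .sine => Real.pi / 4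

/-- The base angles shift the doubled argument by `π` or `π/2`, which turns its cosine into `-cos y`
or `-sin y`. -/
theorem Part.sin_sq_angle_add (s : Part) (y : ℝ) :
    Real.sin (s.angle + y / 2) ^ 2 = (1 + s.eval y) / 2 := by
  rw [Real.sin_sq_eq_half_sub]
  cases s
  · rw [Part.angle, Part.eval, show 2 * (Real.pi / 2 + y / 2) = y + Real.pi by ring,
      Real.cos_add_pi]
    ring
  · rw [Part.angle, Part.eval, show 2 * (Real.pi / 4 + y / 2) = y + Real.pi / 2 by ring,
      Real.cos_add_pi_div_two]
    ring

/-- The controls and angles of the evaluation circuit: one rotation for each pair of a digit of a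
value and a digit of the corresponding holding time. -/
def evalAngles (n lτ w : ℕ) (wt : Fin lx → ℝ) (base c : ℝ) :
    List (Finset (Wire n lx lτ w ⊕ Unit) × ℝ) :=
  (∅, base) :: (Finset.univ : Finset (Fin n × Fin lx × Fin lτ)).toList.map fun p =>
    ({Sum.inl (Sum.inl (p.1, p.2.1)), Sum.inl (Sum.inr (Sum.inl (p.1, p.2.2)))},
      c / 2 * (wt p.2.1 * 2 ^ (p.2.2 : ℕ)))

theorem notMem_evalAngles {wt : Fin lx → ℝ} {base c : ℝ} :
    ∀ p ∈ evalAngles n lτ w wt base c, Sum.inr () ∉ p.1 := by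
  intro p hp
  simp only [evalAngles, List.mem_cons, List.mem_map] at hp
  rcases hp with rfl | ⟨q, -, rfl⟩ <;> simp

theorem card_le_of_mem_evalAngles {wt : Fin lx → ℝ} {base c : ℝ} :
    ∀ p ∈ evalAngles n lτ w wt base c, p.1.card ≤ 2 := by
  intro p hp
  simp only [evalAngles, List.mem_cons, List.mem_map] at hp
  rcases hp with rfl | ⟨q, -, rfl⟩
  · simp
  · exact Finset.card_le_two

theorem totalAngle_evalAngles (wt : Fin lx → ℝ) (base c : ℝ) (xb : Fin n → Fin lx → Bool)
    (tb : Fin n → Fin lτ → Bool) (wb : Fin w → Bool) (y : Unit → Bool) :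
    Circuit.totalAngle (evalAngles n lτ w wt base c) (Sum.elim
      (Sum.elim (fun p => xb p.1 p.2) (Sum.elim (fun p => tb p.1 p.2) wb)) y) =
      base + c * bitIntegral wt xb tb / 2 := by
  simp only [Circuit.totalAngle, evalAngles, List.map_cons, List.sum_cons, List.map_map,
    Finset.notMem_empty, false_imp_iff, implies_true, if_true]
  congr 1
  rw [Finset.sum_map_toList]
  simp only [Function.comp_def, Finset.mem_insert, Finset.mem_singleton, forall_eq_or_imp,
    forall_eq, Sum.elim_inl, Sum.elim_inr]
  rw [Fintype.sum_prod_type, bitIntegral, Finset.mul_sum, Finset.sum_div]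
  refine Finset.sum_congr rfl fun j _ => ?_
  rw [Fintype.sum_prod_type, bitValue, bitNat]
  push_cast
  rw [Finset.sum_mul_sum, Finset.mul_sum, Finset.sum_div]
  refine Finset.sum_congr rfl fun i _ => ?_
  rw [Finset.mul_sum, Finset.sum_div]
  refine Finset.sum_congr rfl fun k _ => ?_
  by_cases h1 : xb j i = true <;> by_cases h2 : tb j k = true <;> simp [h1, h2]
  ring

/-- The circuit which follows the preparation. -/
def rotationCircuit (n lτ w : ℕ) (wt : Fin lx → ℝ) (P : ℝ) {L : ℕ} (s : Term L) :
    Circuit (Wire n lx lτ w ⊕ Unit) :=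
  Circuit.rotations (Sum.inr ()) (evalAngles n lτ w wt s.part.angle (2 * Real.pi * s.freq / P))

theorem isRotationCircuit_rotationCircuit (wt : Fin lx → ℝ) (P : ℝ) {L : ℕ} (s : Term L) :
    IsRotationCircuit (rotationCircuit n lτ w wt P s) := by
  intro ly hly g hg
  simp only [rotationCircuit, Circuit.rotations, Circuit.ofGates, List.map_map, List.mem_map] at hly
  obtain ⟨p, hp, rfl⟩ := hly
  rw [Function.comp_apply, Layer.single, List.mem_singleton] at hg
  subst hg
  exact ⟨rfl, Gate.elementary_crot _ _ (card_le_of_mem_evalAngles p hp), p.2, rfl⟩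

theorem depth_rotationCircuit (wt : Fin lx → ℝ) (P : ℝ) {L : ℕ} (s : Term L) :
    (rotationCircuit n lτ w wt P s).depth = n * lx * lτ + 1 := by
  rw [rotationCircuit, Circuit.rotations, Circuit.depth_ofGates, List.length_map, evalAngles,
    List.length_cons, List.length_map, Finset.length_toList, Finset.card_univ]
  simp [mul_assoc]

theorem depth_evalCircuit (wt : Fin lx → ℝ) (P : ℝ) {L : ℕ} (s : Term L)
    (prep : Circuit (Wire n lx lτ w)) :
    (evalCircuit prep (rotationCircuit n lτ w wt P s)).depth =
      prep.depth + n * lx * lτ + 1 := by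
  rw [evalCircuit, Circuit.depth_append, Circuit.depth_onWires, depth_rotationCircuit, add_assoc]

theorem sum_wire (F : (Wire n lx lτ w → Bool) → ℝ) :
    ∑ x, F x = ∑ xb : Fin n → Fin lx → Bool, ∑ tb : Fin n → Fin lτ → Bool, ∑ wb : Fin w → Bool,
      F (Sum.elim (fun p => xb p.1 p.2) (Sum.elim (fun p => tb p.1 p.2) wb)) := by
  rw [← (Equiv.sumArrowEquivProdArrow _ _ Bool).symm.sum_comp, Fintype.sum_prod_type,
    ← (Equiv.curry (Fin n) (Fin lx) Bool).symm.sum_comp]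
  refine Finset.sum_congr rfl fun xb _ => ?_
  rw [← (Equiv.sumArrowEquivProdArrow _ _ Bool).symm.sum_comp, Fintype.sum_prod_type,
    ← (Equiv.curry (Fin n) (Fin lτ) Bool).symm.sum_comp]
  rfl

/-- The preparation leaves the target qubit at `0`, so `sum_rotations` gives the mean of the squared
sine under the outcome law. The angle depends on the data and time registers only, and their
marginal is the law of the process. -/
theorem targetProb_evalCircuit {Ω : Type*} [MeasurableSpace Ω] {μ : MeasureTheory.Measure Ω}
    [MeasureTheory.IsProbabilityMeasure μ] {X : ℝ → Ω → ℝ} {wt : Fin lx → ℝ}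
    (R : HoldingTimeRep μ X n lx lτ wt) {prep : Circuit (Wire n lx lτ w)} (h : Prepares prep R)
    (P : ℝ) {L : ℕ} (s : Term L) :
    targetProb (evalCircuit prep (rotationCircuit n lτ w wt P s)) =
      (1 + ∫ ω, s.part.eval (2 * Real.pi * s.freq / P * R.pathIntegral ω) ∂μ) / 2 := by
  have hclean : Circuit.Clean {Sum.inr ()}
      ((prep.onWires Function.Embedding.inl).apply (zeroState (Wire n lx lτ w ⊕ Unit))) :=
    (Circuit.avoids_onWires _ _ (by simp)).clean_apply (Circuit.clean_zeroState _)
  have h1 := Circuit.sum_rotations (notMem_evalAngles (n := n) (lτ := lτ) (w := w) (wt := wt)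
    (base := s.part.angle) (c := 2 * Real.pi * s.freq / P)) hclean
  have h2 := Circuit.sum_onWires_inl (β := Unit) prep fun z => Real.sin (Circuit.totalAngle
    (evalAngles n lτ w wt s.part.angle (2 * Real.pi * s.freq / P)) z) ^ 2
  have h3 := R.integral_comp_pathIntegral fun y =>
    (1 + s.part.eval (2 * Real.pi * s.freq / P * y)) / 2
  have h4 : ∫ ω, (1 + s.part.eval (2 * Real.pi * s.freq / P * R.pathIntegral ω)) / 2 ∂μ =
      (1 + ∫ ω, s.part.eval (2 * Real.pi * s.freq / P * R.pathIntegral ω) ∂μ) / 2 := by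
    rw [MeasureTheory.integral_div, MeasureTheory.integral_add (MeasureTheory.integrable_const _)
      (R.integrable_comp_pathIntegral fun y => s.part.eval (2 * Real.pi * s.freq / P * y))]
    simp
  rw [← h4, h3]
  simp only [targetProb, Circuit.outcomeProb, evalCircuit, Circuit.apply_append] at h2 ⊢
  rw [rotationCircuit, h1, h2, sum_wire]
  refine Finset.sum_congr rfl fun xb _ => Finset.sum_congr rfl fun tb _ => ?_
  simp only [totalAngle_evalAngles]
  rw [← h xb tb, ← Finset.mul_sum, Part.sin_sq_angle_add]
  rfl

theorem targetProb_mem_Icc {ι : Type*} [Fintype ι] [DecidableEq ι] (c : Circuit (ι ⊕ Unit)) :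
    targetProb c ∈ Set.Icc 0 1 := by
  constructor
  · exact Finset.sum_nonneg fun x _ => by split_ifs <;> simp [c.outcomeProb_nonneg]
  · rw [← c.sum_outcomeProb]
    exact Finset.sum_le_sum fun x _ => by split_ifs <;> simp [c.outcomeProb_nonneg]

end Evaluation

/-! The runs of the estimation procedure. -/

section Sampling

variable {S ι κ : Type*} [DecidableEq ι] [DecidableEq κ]

/-- A circuit of elementary gates as a list of steps. -/
def stepsOf (S : Type*) (c : Circuit κ) (h : ∀ ly ∈ c, Layer.Elementary ly) : List (Step S κ) :=
  c.pmap Step.layer h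

theorem flatMap_stepsOf (e : ι ↪ κ) (A : S → Circuit ι) (c : Circuit κ)
    (h : ∀ ly ∈ c, Layer.Elementary ly) :
    (stepsOf S c h).flatMap (Step.expand e A) = c := by
  induction c with
  | nil => rfl
  | cons ly c ih =>
    have := ih fun l hl => h l (List.mem_cons_of_mem _ hl)
    simp only [stepsOf, List.pmap_cons, List.flatMap_cons] at this ⊢
    rw [this]
    rfl

theorem elementary_adjoint {c : Circuit κ} (h : ∀ ly ∈ c, Layer.Elementary ly) :
    ∀ ly ∈ c.adjoint, Layer.Elementary ly := by
  intro ly hly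
  simp only [Circuit.adjoint, List.mem_reverse, List.mem_map] at hly
  obtain ⟨l, hl, rfl⟩ := hly
  exact Layer.elementary_adjoint (h l hl)

/-- The angles of the rotations of the flag qubit, the second controlled on the qubit `t`. -/
def flagAngles (t : κ) : List (Finset κ × ℝ) :=
  [(∅, Real.arccos (4 / 5) / 2), ({t}, Real.pi / 6 - Real.arccos (4 / 5) / 2)]

/-- The rotations of the flag qubit `g`, by which it becomes `1` with a probability that is an
increasing affine function of the probability that the qubit `t` is `1`. -/
def flagCircuit (t g : κ) : Circuit κ := Circuit.rotations g (flagAngles t)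

theorem flagCircuit_elementary (t g : κ) : ∀ ly ∈ flagCircuit t g, Layer.Elementary ly := by
  intro ly hly
  simp only [flagCircuit, Circuit.rotations, Circuit.ofGates, flagAngles, List.map_cons,
    List.map_nil, List.mem_cons, List.not_mem_nil, or_false] at hly
  rcases hly with rfl | rfl
  · exact Layer.elementary_single (Gate.elementary_crot _ _ (by simp))
  · exact Layer.elementary_single (Gate.elementary_crot _ _ (by simp))

theorem flagCircuit_avoids {t g : κ} {s : Set κ} (hg : g ∉ s) : (flagCircuit t g).Avoids s :=
  Circuit.ofGates_avoids fun h hh => by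
    simp only [List.mem_map] at hh
    obtain ⟨p, -, rfl⟩ := hh
    exact hg

theorem pauliZ_elementary (g : κ) :
    ∀ ly ∈ Circuit.ofGates [Gate.pauliZ g], Layer.Elementary ly := by
  intro ly hly
  simp only [Circuit.ofGates, List.map_cons, List.map_nil, List.mem_singleton] at hly
  subst hly
  exact Layer.elementary_single (Gate.elementary_pauliZ g)

variable [Fintype ι]

/-- The number of ancilla qubits: one flag qubit, one initial qubit of the ladder, and one qubit of
the ladder for the flag qubit and each qubit of the subroutines. -/
def numAncilla (ι : Type*) [Fintype ι] : ℕ := Fintype.card (Option (Option (Option ι)))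

/-- The ancilla qubits. -/
def ancilla (o : Option (Option (Option ι))) : ι ⊕ Fin (numAncilla ι) :=
  Sum.inr (Fintype.equivFin _ o)

/-- The flag qubit. -/
def flagQubit : ι ⊕ Fin (numAncilla ι) := ancilla none

/-- The qubits that are tested for being `0`. -/
def testedQubit (o : Option ι) : ι ⊕ Fin (numAncilla ι) := o.elim flagQubit Sum.inl

omit [DecidableEq ι] in
theorem ancilla_injective : Function.Injective (ancilla (ι := ι)) :=
  Sum.inr_injective.comp (Equiv.injective _)

/-- The qubits of the ladder. -/
def ladderPairs (ι : Type*) [Fintype ι] :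
    List ((ι ⊕ Fin (numAncilla ι)) × (ι ⊕ Fin (numAncilla ι))) :=
  (Finset.univ : Finset (Option ι)).toList.map fun o => (testedQubit o, ancilla (some (some o)))

/-- The reflection about the zero state. -/
def zeroReflection (ι : Type*) [Fintype ι] [DecidableEq ι] : Circuit (ι ⊕ Fin (numAncilla ι)) :=
  Circuit.reflectZero (ancilla (some none)) (ladderPairs ι)

theorem zeroReflection_elementary : ∀ ly ∈ zeroReflection ι, Layer.Elementary ly :=
  Circuit.reflectZero_elementary _ _

/-- The qubits which are used by the reflection only. -/
def ladderQubits (ι : Type*) [Fintype ι] : Set (ι ⊕ Fin (numAncilla ι)) :=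
  {i | i = ancilla (some none) ∨ i ∈ (ladderPairs ι).map Prod.snd}

omit [DecidableEq ι] in
theorem mem_map_snd_ladderPairs {i : ι ⊕ Fin (numAncilla ι)} :
    i ∈ (ladderPairs ι).map Prod.snd ↔ ∃ o, ancilla (some (some o)) = i := by
  simp [ladderPairs]

omit [DecidableEq ι] in
theorem mem_map_fst_ladderPairs {i : ι ⊕ Fin (numAncilla ι)} :
    i ∈ (ladderPairs ι).map Prod.fst ↔ ∃ o, testedQubit o = i := by
  simp [ladderPairs]

omit [DecidableEq ι] in
theorem inl_notMem_ladderQubits (i : ι) : Sum.inl i ∉ ladderQubits ι := by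
  simp [ladderQubits, mem_map_snd_ladderPairs, ancilla]

omit [DecidableEq ι] in
theorem flagQubit_notMem_ladderQubits : flagQubit ∉ ladderQubits ι := by
  simp [ladderQubits, mem_map_snd_ladderPairs, flagQubit, ancilla_injective.eq_iff]

theorem zeroReflection_apply {χ : (ι ⊕ Fin (numAncilla ι) → Bool) → ℂ}
    (hχ : Circuit.Clean (ladderQubits ι) χ) :
    (zeroReflection ι).apply χ = (2 * χ fun _ => false) • zeroState _ - χ := by
  refine Circuit.reflectZero_apply ?_ ?_ ?_ ?_ hχ
  · rw [ladderPairs, List.map_map]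
    refine (Finset.nodup_toList _).map fun o o' h => ?_
    simpa using ancilla_injective h
  · intro i hi hi'
    rw [mem_map_snd_ladderPairs] at hi
    rw [mem_map_fst_ladderPairs] at hi'
    obtain ⟨o, rfl⟩ := hi
    obtain ⟨o', h⟩ := hi'
    cases o' with
    | none => simpa using ancilla_injective (show ancilla none = _ from h)
    | some i => simp [testedQubit, ancilla] at h
  · rw [mem_map_snd_ladderPairs]
    rintro ⟨o, ho⟩
    simpa using ancilla_injective ho
  -- The flag and the qubits of the subroutine are tested; every other ancilla is a ladder qubit or
  -- its start.
  · rintro (i | i)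
    · exact Or.inr (Or.inl (mem_map_fst_ladderPairs.2 ⟨some i, rfl⟩))
    · obtain ⟨o, rfl⟩ := (Fintype.equivFin (Option (Option (Option ι)))).surjective i
      rcases o with _ | _ | o
      · exact Or.inr (Or.inl (mem_map_fst_ladderPairs.2 ⟨none, rfl⟩))
      · exact Or.inl rfl
      · exact Or.inr (Or.inr (mem_map_snd_ladderPairs.2 ⟨o, rfl⟩))

theorem depth_zeroReflection : (zeroReflection ι).depth = 6 * (Fintype.card ι + 1) + 1 := by
  rw [zeroReflection, Circuit.depth_reflectZero, ladderPairs, List.length_map,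
    Finset.length_toList, Finset.card_univ, Fintype.card_option]

/-- A subroutine followed by the rotations of the flag qubit. -/
def flagged (t : ι) (c : Circuit ι) : Circuit (ι ⊕ Fin (numAncilla ι)) :=
  c.onWires Function.Embedding.inl ++ flagCircuit (Sum.inl t) flagQubit

/-- The steps that call a subroutine and amplify the flag qubit `k` times. -/
def sampleSteps (t : ι) (s : S) (k : ℕ) : List (Step S (ι ⊕ Fin (numAncilla ι))) :=
  let v := .call s :: stepsOf S (flagCircuit (Sum.inl t) flagQubit) (flagCircuit_elementary _ _)
  v ++ (List.replicate k (stepsOf S (Circuit.ofGates [Gate.pauliZ flagQubit]) (pauliZ_elementary _)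
    ++ ((stepsOf S (flagCircuit (Sum.inl t) flagQubit).adjoint
      (elementary_adjoint (flagCircuit_elementary _ _)) ++ [.callInv s])
    ++ (stepsOf S (zeroReflection ι) zeroReflection_elementary ++ v)))).flatten

theorem flatMap_sampleSteps (t : ι) (s : S) (k : ℕ) (A : S → Circuit ι) :
    (sampleSteps t s k).flatMap (Step.expand Function.Embedding.inl A) =
      Circuit.amplify (flagged t (A s)) (zeroReflection ι) flagQubit k := by
  have hrep : ∀ l : List (Step S (ι ⊕ Fin (numAncilla ι))),
      (List.replicate k l).flatten.flatMap (Step.expand Function.Embedding.inl A) =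
        (List.replicate k (l.flatMap (Step.expand Function.Embedding.inl A))).flatten := by
    intro l
    induction k with
    | zero => rfl
    | succ k ih => simp only [List.replicate_succ, List.flatten_cons, List.flatMap_append, ih]
  simp only [sampleSteps, List.flatMap_append, hrep, List.flatMap_cons, List.flatMap_nil,
    flatMap_stepsOf, Circuit.amplify, Circuit.groverStep, flagged, Circuit.adjoint_append,
    Step.expand, List.append_nil]

theorem depth_amplify_flagged (t : ι) (c : Circuit ι) (k : ℕ) :
    (Circuit.amplify (flagged t c) (zeroReflection ι) flagQubit k).depth ≤
      (2 * k + 1) * (c.depth + 6 * Fintype.card ι + 10) := by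
  have h1 : (flagged t c).depth = c.depth + 2 := by
    rw [flagged, Circuit.depth_append, Circuit.depth_onWires]
    rfl
  rw [Circuit.depth_amplify, h1, depth_zeroReflection]
  nlinarith

end Sampling

section SampleProb

variable {ι : Type*} [DecidableEq ι] [Fintype ι]

/-- The phase that the amplified flag qubit reveals. -/
def probPhase (p : ℝ) : ℝ := Real.arccos (4 / 5 - 3 / 10 * p)

theorem cos_probPhase {p : ℝ} (hp : p ∈ Set.Icc (0 : ℝ) 1) :
    Real.cos (probPhase p) = 4 / 5 - 3 / 10 * p :=
  Real.cos_arccos (by linarith [hp.2]) (by linarith [hp.1])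

theorem phaseRange_probPhase {p : ℝ} (hp : p ∈ Set.Icc (0 : ℝ) 1) : PhaseRange (probPhase p) :=
  ⟨⟨Real.arccos_nonneg _, Real.arccos_le_pi _⟩, by
    rw [cos_probPhase hp]
    constructor <;> linarith [hp.1, hp.2]⟩

/-- The flag angles are `arccos(4/5)/2` and `π/6`, with squared sines `1/10` and `1/4`. So the flag
has probability `1/10 + 3p/20 = (1 - cos φ)/2`, with `φ` in the phase range for every `p`. -/
theorem sum_flagged (c : Circuit (ι ⊕ Unit)) :
    ∑ z, (if z flagQubit then (flagged (Sum.inr ()) c).outcomeProb z else 0) =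
      Real.sin (probPhase (targetProb c) / 2) ^ 2 := by
  have hfl : ∀ p ∈ flagAngles (Sum.inl (Sum.inr ()) : (ι ⊕ Unit) ⊕ Fin (numAncilla (ι ⊕ Unit))),
      flagQubit ∉ p.1 := by
    intro p hp
    simp only [flagAngles, List.mem_cons, List.not_mem_nil, or_false] at hp
    rcases hp with rfl | rfl <;> simp [flagQubit, ancilla]
  have hclean : Circuit.Clean {flagQubit} ((c.onWires Function.Embedding.inl).apply
      (zeroState ((ι ⊕ Unit) ⊕ Fin (numAncilla (ι ⊕ Unit))))) :=
    (Circuit.avoids_onWires _ _ (by simp [flagQubit, ancilla])).clean_apply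
      (Circuit.clean_zeroState _)
  have h1 := Circuit.sum_rotations hfl hclean
  have h2 := Circuit.sum_onWires_inl (β := Fin (numAncilla (ι ⊕ Unit))) c fun z =>
    Real.sin (Circuit.totalAngle (flagAngles (Sum.inl (Sum.inr ()))) z) ^ 2
  simp only [Circuit.outcomeProb, flagged, Circuit.apply_append] at h2 ⊢
  rw [flagCircuit, h1, h2]
  have hpt : ∀ x : ι ⊕ Unit → Bool, Real.sin (Circuit.totalAngle (flagAngles (Sum.inl (Sum.inr ())))
      (Sum.elim x fun _ : Fin (numAncilla (ι ⊕ Unit)) => false)) ^ 2 =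
      1 / 10 + if x (Sum.inr ()) then 3 / 20 else 0 := by
    intro x
    have htot : Circuit.totalAngle (flagAngles (Sum.inl (Sum.inr ())))
        (Sum.elim x fun _ : Fin (numAncilla (ι ⊕ Unit)) => false) =
        Real.arccos (4 / 5) / 2 + if x (Sum.inr ()) then
          Real.pi / 6 - Real.arccos (4 / 5) / 2 else 0 := by
      by_cases hx : x (Sum.inr ()) = true <;> simp [Circuit.totalAngle, flagAngles, hx]
    rw [htot, Real.sin_sq_eq_half_sub]
    split_ifs
    · rw [show 2 * (Real.arccos (4 / 5) / 2 + (Real.pi / 6 - Real.arccos (4 / 5) / 2)) =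
        Real.pi / 3 by ring, Real.cos_pi_div_three]
      norm_num
    · rw [show 2 * (Real.arccos (4 / 5) / 2 + 0) = Real.arccos (4 / 5) by ring,
        Real.cos_arccos (by norm_num) (by norm_num)]
      norm_num
  have hsin : Real.sin (probPhase (targetProb c) / 2) ^ 2 = 1 / 10 + 3 / 20 * targetProb c := by
    rw [Real.sin_sq_eq_half_sub, mul_div_cancel₀ _ (two_ne_zero' ℝ),
      cos_probPhase (targetProb_mem_Icc c)]
    ring
  have hsum := c.sum_outcomeProb
  simp only [Circuit.outcomeProb] at hsum
  rw [hsin, targetProb, Finset.mul_sum]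
  have hone : (1 / 10 : ℝ) = ∑ x, 1 / 10 * ‖c.apply (zeroState (ι ⊕ Unit)) x‖ ^ 2 := by
    rw [← Finset.mul_sum, hsum, mul_one]
  rw [hone, ← Finset.sum_add_distrib]
  refine Finset.sum_congr rfl fun x _ => ?_
  rw [hpt, Circuit.outcomeProb]
  split_ifs <;> ring

theorem sum_amplify_flagged (c : Circuit (ι ⊕ Unit)) (j : ℕ) (b : Bool) :
    ∑ z, (if z flagQubit then (Circuit.amplify (flagged (Sum.inr ()) c) (zeroReflection (ι ⊕ Unit))
      flagQubit (levelSteps j b)).outcomeProb z else 0) =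
      levelProb (probPhase (targetProb c)) j b := by
  have hr := phaseRange_probPhase (targetProb_mem_Icc c)
  have hpi := Real.pi_pos
  have hle := hr.le_pi_div_three
  -- Since `cos φ ≤ 4/5`, the flag has positive probability even when `p = 0`.
  have hsin : Real.sin (probPhase (targetProb c) / 2) ≠ 0 := by
    have h := Real.sin_sq_eq_half_sub (probPhase (targetProb c) / 2)
    rw [mul_div_cancel₀ _ (two_ne_zero' ℝ)] at h
    intro h0
    rw [h0] at h
    linarith [hr.2.2]
  have hcos : Real.cos (probPhase (targetProb c) / 2) ≠ 0 :=
    (Real.cos_pos_of_mem_Ioo ⟨by linarith [hr.1.1], by linarith⟩).ne'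
  have hV : (flagged (Sum.inr ()) c).Avoids (ladderQubits (ι ⊕ Unit)) :=
    (Circuit.avoids_onWires _ _ inl_notMem_ladderQubits).append
      (flagCircuit_avoids flagQubit_notMem_ladderQubits)
  rw [Circuit.sum_amplify hV (fun χ hχ => zeroReflection_apply hχ) (sum_flagged c) hsin hcos,
    two_mul_levelSteps, levelProb]

end SampleProb

/-! The estimation procedure. -/

section Estimation

variable {S T ι : Type*} [Fintype T] [Fintype ι] [DecidableEq ι]

/-- The runs: for each target quantity `s`, each level `j < N s` and each of its two circuits,
there are `2 ^ (N s - j)` runs. -/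
abbrev RunIndex (N : T → ℕ) : Type _ := Σ s : T, Σ j : Fin (N s), Bool × Fin (2 ^ (N s - j))

/-- The runs of one of the two circuits of the level `j`. -/
def runGroup (N : T → ℕ) (s : T) (j : ℕ) (b : Bool) : Finset (Fin (Fintype.card (RunIndex N))) :=
  if h : j < N s then
    Finset.univ.image fun i : Fin (2 ^ (N s - j)) =>
      Fintype.equivFin (RunIndex N) ⟨s, ⟨j, h⟩, b, i⟩
  else ∅

theorem card_runGroup (N : T → ℕ) (s : T) {j : ℕ} (hj : j < N s) (b : Bool) :
    (runGroup N s j b).card = 2 ^ (N s - j) := by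
  rw [runGroup, dif_pos hj, Finset.card_image_of_injective, Finset.card_univ, Fintype.card_fin]
  intro i i' h
  simpa using h

/-- The frequency of reading `1` on the flag qubit. -/
def flagFreq (N : T → ℕ) (o : Fin (Fintype.card (RunIndex N)) →
    (ι ⊕ Unit) ⊕ Fin (numAncilla (ι ⊕ Unit)) → Bool) (s : T) (j : ℕ) (b : Bool) : ℝ :=
  (∑ r ∈ runGroup N s j b, if o r flagQubit then 1 else 0) / ((runGroup N s j b).card : ℝ)

/-- The procedure that estimates `c + ∑ s, γ s * (2 * p s - 1)`, where `p s` is the probability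
that the target qubit of the circuit with index `term s` is `1`. -/
abbrev estimation (ι : Type*) [Fintype ι] [DecidableEq ι] (term : T → S) (N : T → ℕ) (c : ℝ)
    (γ : T → ℝ) : Procedure S (ι ⊕ Unit) where
  ancilla := numAncilla (ι ⊕ Unit)
  numRuns := Fintype.card (RunIndex N)
  run r :=
    let i := (Fintype.equivFin (RunIndex N)).symm r
    sampleSteps (Sum.inr ()) (term i.1) (levelSteps i.2.1 i.2.2.1)
  estimate o := c + ∑ s, γ s * ((13 - 20 * Real.cos (phaseEstimate (N s) (flagFreq N o s))) / 3)

variable (term : T → S) (N : T → ℕ) (c : ℝ) (γ : T → ℝ) (A : S → Circuit (ι ⊕ Unit))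

theorem circuit_estimation (i : RunIndex N) :
    (estimation ι term N c γ).circuit A (Fintype.equivFin (RunIndex N) i) =
      Circuit.amplify (flagged (Sum.inr ()) (A (term i.1))) (zeroReflection (ι ⊕ Unit)) flagQubit
        (levelSteps i.2.1 i.2.2.1) := by
  have : (estimation ι term N c γ).run (Fintype.equivFin (RunIndex N) i) =
      sampleSteps (Sum.inr ()) (term i.1) (levelSteps i.2.1 i.2.2.1) := by
    change sampleSteps (Sum.inr ()) _ _ = _
    rw [Equiv.symm_apply_apply]
  exact (congrArg _ this).trans (flatMap_sampleSteps _ _ _ _)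

/-- The subtracted power matters: the sum is zero for `N = 0`, so a term that needs no run costs
nothing. -/
theorem sum_pow_levels (N : ℕ) :
    ∑ j ∈ Finset.range N, (2 : ℝ) ^ (N - j) * 3 ^ j = 2 * (3 ^ N - 2 ^ N) := by
  induction N with
  | zero => simp
  | succ N ih =>
    have : ∀ j ∈ Finset.range N, (2 : ℝ) ^ (N + 1 - j) * 3 ^ j = 2 * (2 ^ (N - j) * 3 ^ j) := by
      intro j hj
      rw [Nat.succ_sub (Finset.mem_range.1 hj).le, pow_succ]
      ring
    rw [Finset.sum_range_succ, Finset.sum_congr rfl this, ← Finset.mul_sum, ih,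
      Nat.add_sub_cancel_left]
    ring

theorem time_estimation_le {D : ℝ}
    (hD : ∀ s, ((A s).depth + 6 * Fintype.card (ι ⊕ Unit) + 10 : ℝ) ≤ D) :
    ((estimation ι term N c γ).time A : ℝ) ≤ 12 * D * ∑ s, ((3 : ℝ) ^ N s - 2 ^ N s) := by
  have h1 : (estimation ι term N c γ).time A = ∑ i : RunIndex N,
      (Circuit.amplify (flagged (Sum.inr ()) (A (term i.1))) (zeroReflection (ι ⊕ Unit)) flagQubit
        (levelSteps i.2.1 i.2.2.1)).depth := by
    rw [Procedure.time]
    exact ((Fintype.equivFin (RunIndex N)).sum_comp fun r =>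
      ((estimation ι term N c γ).circuit A r).depth).symm.trans
        (Finset.sum_congr rfl fun i _ => congrArg Circuit.depth (circuit_estimation ..))
  have h2 : ∀ i : RunIndex N, ((Circuit.amplify (flagged (Sum.inr ()) (A (term i.1)))
      (zeroReflection (ι ⊕ Unit)) flagQubit (levelSteps i.2.1 i.2.2.1)).depth : ℝ) ≤
      3 * 3 ^ (i.2.1 : ℕ) * D := by
    intro i
    have hd := depth_amplify_flagged (Sum.inr ()) (A (term i.1)) (levelSteps i.2.1 i.2.2.1)
    have hd' : ((Circuit.amplify (flagged (Sum.inr ()) (A (term i.1)))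
      (zeroReflection (ι ⊕ Unit)) flagQubit (levelSteps i.2.1 i.2.2.1)).depth : ℝ) ≤
      (2 * (levelSteps i.2.1 i.2.2.1 : ℝ) + 1) *
        ((A (term i.1)).depth + 6 * Fintype.card (ι ⊕ Unit) + 10) := by exact_mod_cast hd
    rw [two_mul_levelSteps] at hd'
    have h3 : (1 : ℝ) ≤ 3 ^ (i.2.1 : ℕ) := one_le_pow₀ (by norm_num)
    -- This is `3^j + 2 ≤ 3 · 3^j`, an equality at `j = 0`.
    have h4 : levelMul i.2.1 i.2.2.1 ≤ 3 * 3 ^ (i.2.1 : ℕ) := by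
      unfold levelMul
      split_ifs <;> linarith
    exact hd'.trans (mul_le_mul h4 (hD _) (by positivity) (by positivity))
  rw [h1, Nat.cast_sum]
  refine (Finset.sum_le_sum fun i _ => h2 i).trans (le_of_eq ?_)
  rw [Fintype.sum_sigma, Finset.mul_sum]
  refine Finset.sum_congr rfl fun s _ => ?_
  rw [Fintype.sum_sigma]
  have h5 : ∀ j : Fin (N s), ∑ _i : Bool × Fin (2 ^ (N s - j)), 3 * 3 ^ (j : ℕ) * D =
      6 * D * (2 ^ (N s - j) * 3 ^ (j : ℕ)) := by
    intro j
    rw [Finset.sum_const, Finset.card_univ, Fintype.card_prod, Fintype.card_bool, Fintype.card_fin,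
      nsmul_eq_mul]
    push_cast
    ring
  rw [Finset.sum_congr rfl fun j _ => h5 j, ← Finset.mul_sum,
    Fin.sum_univ_eq_sum_range fun j => (2 : ℝ) ^ (N s - j) * 3 ^ j, sum_pow_levels]
  ring

/-- Markov's inequality for the error of the estimate. -/
theorem one_sub_le_probWithin (p : Procedure S (ι ⊕ Unit)) {v ε : ℝ} (hε : 0 < ε) :
    1 - expect (fun r => (p.circuit A r).outcomeProb) (fun o => |p.estimate o - v|) / ε ≤
      p.probWithin A v ε := by
  set w := fun r => (p.circuit A r).outcomeProb with hw
  have hw0 : ∀ r x, 0 ≤ w r x := fun r x => Circuit.outcomeProb_nonneg _ _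
  have hw1 : ∀ r, ∑ x, w r x = 1 := fun r => Circuit.sum_outcomeProb _
  have h1 : p.probWithin A v ε = expect w fun o => if |p.estimate o - v| ≤ ε then 1 else 0 := by
    refine Finset.sum_congr rfl fun o _ => ?_
    beta_reduce
    by_cases h : |p.estimate o - v| ≤ ε
    · rw [if_pos h, if_pos h, one_mul]
    · rw [if_neg h, if_neg h, zero_mul]
  have h2 : ∀ o, 1 ≤ (if |p.estimate o - v| ≤ ε then (1 : ℝ) else 0) +
      1 / ε * |p.estimate o - v| := by
    intro o
    split_ifs with h
    · have : 0 ≤ 1 / ε * |p.estimate o - v| := by positivity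
      linarith
    · rw [zero_add, one_div_mul_eq_div, one_le_div hε]
      exact (not_le.1 h).le
  have h3 := expect_mono hw0 h2
  rw [expect_const hw1, expect_add, expect_const_mul, ← h1] at h3
  rw [sub_le_iff_le_add, div_eq_mul_one_div, mul_comm (expect _ _)]
  exact h3

theorem probWithin_mono (p : Procedure S (ι ⊕ Unit)) {v v' ε ε' : ℝ} (h : ε + |v - v'| ≤ ε') :
    p.probWithin A v ε ≤ p.probWithin A v' ε' := by
  refine Finset.sum_le_sum fun o _ => ?_
  have hnn : 0 ≤ ∏ r, (p.circuit A r).outcomeProb (o r) :=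
    Finset.prod_nonneg fun r _ => Circuit.outcomeProb_nonneg _ _
  split_ifs with h1 h2 h2
  · exact le_rfl
  · exact absurd ((abs_sub_le _ v _).trans (by linarith)) h2
  · exact hnn
  · exact le_rfl

/-- The constant in the expected error of the estimates. -/
def errorConst : ℝ := 20 / 3 * (10 * 64 ^ 5)

/-- Solving `cos φ = 4/5 - 3p/10` gives `2p - 1 = (13 - 20 cos φ)/3`, which is Lipschitz in `φ` with
constant `20/3`. The triangle inequality then reduces the bound to the phase errors. -/
theorem expect_estimation_le :
    expect (fun r => ((estimation ι term N c γ).circuit A r).outcomeProb)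
      (fun o => |(estimation ι term N c γ).estimate o -
        (c + ∑ s, γ s * (2 * targetProb (A (term s)) - 1))|) ≤
      ∑ s, |γ s| * (errorConst * (1 / 3) ^ N s) := by
  set w := fun r => ((estimation ι term N c γ).circuit A r).outcomeProb with hw
  have hw0 : ∀ r x, 0 ≤ w r x := fun r x => Circuit.outcomeProb_nonneg _ _
  have hw1 : ∀ r, ∑ x, w r x = 1 := fun r => Circuit.sum_outcomeProb _
  set φ : T → ℝ := fun s => probPhase (targetProb (A (term s))) with hφ
  have hpt : ∀ o, |(estimation ι term N c γ).estimate o -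
        (c + ∑ s, γ s * (2 * targetProb (A (term s)) - 1))| ≤
      ∑ s, |γ s| * (20 / 3) * |phaseEstimate (N s) (flagFreq N o s) - φ s| := by
    intro o
    have hs : ∀ s, 2 * targetProb (A (term s)) - 1 = (13 - 20 * Real.cos (φ s)) / 3 := by
      intro s
      rw [hφ]
      simp only
      rw [cos_probPhase (targetProb_mem_Icc _)]
      ring
    simp only [hs]
    rw [add_sub_add_left_eq_sub, ← Finset.sum_sub_distrib]
    refine (Finset.abs_sum_le_sum_abs _ _).trans (Finset.sum_le_sum fun s _ => ?_)
    rw [← mul_sub, abs_mul, mul_assoc]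
    refine mul_le_mul_of_nonneg_left ?_ (abs_nonneg _)
    have hlip := Real.abs_cos_sub_cos_le (phaseEstimate (N s) (flagFreq N o s)) (φ s)
    rw [show (13 - 20 * Real.cos (phaseEstimate (N s) (flagFreq N o s))) / 3 -
      (13 - 20 * Real.cos (φ s)) / 3 = -(20 / 3) *
      (Real.cos (phaseEstimate (N s) (flagFreq N o s)) - Real.cos (φ s)) by ring, abs_mul, abs_neg,
      abs_of_pos (show (0 : ℝ) < 20 / 3 by norm_num)]
    linarith
  refine (expect_mono hw0 hpt).trans ?_
  rw [expect_sum]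
  refine Finset.sum_le_sum fun s _ => ?_
  rw [expect_const_mul, errorConst, mul_assoc, mul_assoc (20 / 3 : ℝ)]
  refine mul_le_mul_of_nonneg_left (mul_le_mul_of_nonneg_left ?_ (by norm_num)) (abs_nonneg _)
  refine expect_phaseEstimate_le hw0 hw1 (N s) (runGroup N s) (fun x => x flagQubit)
    (phaseRange_probPhase (targetProb_mem_Icc _)) (fun j hj b => card_runGroup N s hj b) ?_
  intro j hj b r hr
  rw [runGroup, dif_pos hj] at hr
  obtain ⟨i, -, rfl⟩ := Finset.mem_image.1 hr
  rw [← sum_amplify_flagged]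
  have := circuit_estimation term N c γ A ⟨s, ⟨j, hj⟩, b, i⟩
  exact Finset.sum_congr rfl fun z _ => if_congr Iff.rfl
    (congrArg (fun d => Circuit.outcomeProb d z) this) rfl

end Estimation

/-! The choice of the numbers of levels. -/

/-- The least admissible `N` works: if `N = 0` the left side vanishes, and otherwise minimality
gives `3^(N-1) < B`. So the cost is linear in `B` even for small `B`. -/
theorem exists_levels {B : ℝ} (hB : 0 ≤ B) :
    ∃ N : ℕ, B ≤ 3 ^ N ∧ (3 : ℝ) ^ N - 2 ^ N ≤ 3 * B := by
  have hex : ∃ N : ℕ, B ≤ 3 ^ N :=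
    (pow_unbounded_of_one_lt B (by norm_num : (1 : ℝ) < 3)).imp fun _ h => h.le
  classical
  refine ⟨Nat.find hex, Nat.find_spec hex, ?_⟩
  rcases h : Nat.find hex with _ | N
  · simpa using hB
  · have := not_le.1 (Nat.find_min hex (show N < Nat.find hex by omega))
    have h2 : (0 : ℝ) < 2 ^ (N + 1) := by positivity
    rw [pow_succ (3 : ℝ)]
    linarith

/-- Telescoping, from `1/√(l+1) ≤ 2(√(l+1) - √l)`. -/
theorem sum_one_div_sqrt_le (L : ℕ) :
    ∑ l ∈ Finset.range L, 1 / √((l + 1 : ℕ) : ℝ) ≤ 2 * √L := by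
  induction L with
  | zero => simp
  | succ L ih =>
    rw [Finset.sum_range_succ]
    have h0 : 0 ≤ √(L : ℝ) := Real.sqrt_nonneg _
    have h1 : 0 < √((L + 1 : ℕ) : ℝ) := Real.sqrt_pos.2 (by positivity)
    have e0 : √(L : ℝ) ^ 2 = L := Real.sq_sqrt (by positivity)
    have e1 : √((L + 1 : ℕ) : ℝ) ^ 2 = L + 1 := by
      rw [Real.sq_sqrt (by positivity)]
      push_cast
      ring
    have : 1 / √((L + 1 : ℕ) : ℝ) ≤ 2 * √((L + 1 : ℕ) : ℝ) - 2 * √(L : ℝ) := by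
      rw [div_le_iff₀ h1]
      nlinarith [sq_nonneg (√((L + 1 : ℕ) : ℝ) - √(L : ℝ))]
    linarith

/-- The term with frequency `l + 1`. -/
def posTerm {L : ℕ} (s : Fin L × Bool) : Term L where
  freq := ((s.1 + 1 : ℕ) : ℤ)
  freq_le := by
    rw [abs_of_nonneg (by positivity)]
    exact_mod_cast s.1.2
  part := if s.2 then .sine else .cosine

theorem sum_fin_prod_bool {L : ℕ} (F : ℕ → Part → ℝ) :
    ∑ s : Fin L × Bool, F (s.1 + 1) (if s.2 then .sine else .cosine) =
      ∑ l ∈ Finset.range L, (F (l + 1) .cosine + F (l + 1) .sine) := by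
  rw [Fintype.sum_prod_type, ← Fin.sum_univ_eq_sum_range fun l => F (l + 1) .cosine + F (l + 1) .sine]
  refine Finset.sum_congr rfl fun l _ => ?_
  rw [Fintype.sum_bool, add_comm]
  rfl

theorem integral_fourierApprox {Ω : Type*} [MeasurableSpace Ω] {μ : MeasureTheory.Measure Ω}
    [MeasureTheory.IsProbabilityMeasure μ] {X : ℝ → Ω → ℝ} {n lx lτ : ℕ} {wt : Fin lx → ℝ}
    (R : HoldingTimeRep μ X n lx lτ wt) (f : ℝ → ℝ) (a : ℝ) {P : ℝ} (hP : 0 < P) (L : ℕ) :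
    ∫ ω, fourierApprox f a hP L (R.pathIntegral ω) ∂μ = (coeff f a hP 0).re +
      ∑ s : Fin L × Bool, termWeight f a hP (s.1 + 1) (posTerm s).part *
        ∫ ω, (posTerm s).part.eval
          (2 * Real.pi * (posTerm s).freq / P * R.pathIntegral ω) ∂μ := by
  have hint : ∀ (l : ℕ) (q : Part), MeasureTheory.Integrable (fun ω => termWeight f a hP l q *
      q.eval (2 * Real.pi * (l : ℕ) / P * R.pathIntegral ω)) μ := fun l q =>
    R.integrable_comp_pathIntegral fun y => termWeight f a hP l q * q.eval (2 * Real.pi * l / P * y)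
  have hint' : ∀ l ∈ Finset.range L, MeasureTheory.Integrable (fun ω =>
      termWeight f a hP (l + 1) .cosine *
        Part.eval .cosine (2 * Real.pi * (l + 1 : ℕ) / P * R.pathIntegral ω) +
      termWeight f a hP (l + 1) .sine *
        Part.eval .sine (2 * Real.pi * (l + 1 : ℕ) / P * R.pathIntegral ω)) μ := fun l _ =>
    (hint (l + 1) .cosine).add (hint (l + 1) .sine)
  simp only [fourierApprox_eq]
  rw [MeasureTheory.integral_add (MeasureTheory.integrable_const _)
    (MeasureTheory.integrable_finsetSum _ hint'), MeasureTheory.integral_finsetSum _ hint']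
  congr 1
  · simp
  · have h := sum_fin_prod_bool (L := L) fun l q => termWeight f a hP l q *
      ∫ ω, q.eval (2 * Real.pi * (l : ℕ) / P * R.pathIntegral ω) ∂μ
    refine Eq.trans (Finset.sum_congr rfl fun l _ => ?_) (h.symm.trans ?_)
    · rw [MeasureTheory.integral_add (hint (l + 1) _) (hint (l + 1) _),
        MeasureTheory.integral_const_mul, MeasureTheory.integral_const_mul]
    · refine Finset.sum_congr rfl fun s _ => ?_
      simp only [posTerm, Int.cast_natCast]

end QCTSP

end

/-! ### Assembly: the choice of levels, the running time and the accuracy. -/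

theorem mainTheorem7 :
    ∃ C : ℝ, 0 < C ∧
      (∀ (n lx lτ w L : ℕ) (wt : Fin lx → ℝ) (f : ℝ → ℝ) (a P K ε : ℝ) (hP : 0 < P),
        0 < n → 0 < lx → 0 < lτ → w ≤ n * (lx + lτ) → 0 < ε →
        IntervalIntegrable f MeasureTheory.volume a (a + P) →
        (∀ l : ℕ, 1 ≤ l → l ≤ L → l * ‖QCTSP.coeff f a hP l‖ ≤ K * P) →
        -- the rotation circuits and the procedure do not depend on the process or its preparation
        ∃ (M : QCTSP.Term L → QCTSP.Circuit (QCTSP.Wire n lx lτ w ⊕ Unit))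
          (proc : QCTSP.Procedure (QCTSP.Term L) (QCTSP.Wire n lx lτ w ⊕ Unit)),
          (∀ s, QCTSP.IsRotationCircuit (M s)) ∧
          ∀ (Ω : Type*) [MeasurableSpace Ω] (μ : MeasureTheory.Measure Ω)
            [MeasureTheory.IsProbabilityMeasure μ] (X : ℝ → Ω → ℝ)
            (R : QCTSP.HoldingTimeRep μ X n lx lτ wt)
            (prep : QCTSP.Circuit (QCTSP.Wire n lx lτ w)),
            QCTSP.Prepares prep R →
            -- the Riemann sum
            (∀ᵐ ω ∂μ, R.pathIntegral ω = ∑ j, R.value j ω * R.hold j ω) ∧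
            -- depth of the evaluation circuits, and the amplitudes they produce
            (∀ s : QCTSP.Term L,
              ((QCTSP.evalCircuit prep (M s)).depth : ℝ) ≤ C * (prep.depth + n * lx * lτ) ∧
              QCTSP.targetProb (QCTSP.evalCircuit prep (M s)) =
                (1 + ∫ ω, s.part.eval (2 * Real.pi * s.freq / P * R.pathIntegral ω) ∂μ) / 2) ∧
            -- running time
            (proc.time (fun s => QCTSP.evalCircuit prep (M s)) : ℝ) ≤
              C * K * (L * P / ε * (prep.depth + n * lx * lτ)) ∧
            -- accuracy
            2 / 3 ≤ proc.probWithin (fun s => QCTSP.evalCircuit prep (M s))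
              (∫ ω, QCTSP.fourierApprox f a hP L (R.pathIntegral ω) ∂μ) ε ∧
            2 / 3 ≤ proc.probWithin (fun s => QCTSP.evalCircuit prep (M s))
              (∫ ω, f (R.pathIntegral ω) ∂μ)
              (ε + ∫ ω, |f (R.pathIntegral ω) -
                QCTSP.fourierApprox f a hP L (R.pathIntegral ω)| ∂μ)) ∧
      -- admissible `K`: total variation of `f` on the window divided by `P`
      (∀ (f : ℝ → ℝ) (a P K : ℝ) (hP : 0 < P), 0 ≤ K →
        eVariationOn f (Set.Icc a (a + P)) ≤ ENNReal.ofReal (K * P) →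
        IntervalIntegrable f MeasureTheory.volume a (a + P) ∧
          ∀ l : ℕ, 1 ≤ l → l * ‖QCTSP.coeff f a hP l‖ ≤ K * P) := by
  have hE0 : 0 < QCTSP.errorConst := by unfold QCTSP.errorConst; norm_num
  -- The factor 42 bounds the depth overhead; `144 · 24 = 12 · 288` combines the constants of
  -- `time_estimation_le` and of the sum over the terms.
  refine ⟨42 * (144 * (24 * QCTSP.errorConst)), by positivity, ?_, ?_⟩
  swap
  · intro f a P K hP hK h
    exact ⟨QCTSP.intervalIntegrable_of_eVariationOn (by linarith)
      (ne_top_of_le_ne_top ENNReal.ofReal_ne_top h),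
      fun l hl => QCTSP.mul_norm_coeff_le hP (by positivity) h hl⟩
  intro n lx lτ w L wt f a P K ε hP hn hlx hlτ hw hε _ hK
  have hE1 : 1 ≤ QCTSP.errorConst := by unfold QCTSP.errorConst; norm_num
  set E := QCTSP.errorConst
  -- Level numbers inversely proportional to `√l` balance the weights `1/l` against the costs. The
  -- factor 24 makes the final expected error `ε/3`.
  have hlev : ∀ s : Fin L × Bool, ∃ N : ℕ, 24 * E * (K * P * √L) / ε / √((s.1 + 1 : ℕ) : ℝ) ≤ 3 ^ N ∧
      (3 : ℝ) ^ N - 2 ^ N ≤ 3 * (24 * E * (K * P * √L) / ε / √((s.1 + 1 : ℕ) : ℝ)) := by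
    intro s
    -- The sign of `K` comes from the coefficient bound at a frequency that occurs.
    have hKP : 0 ≤ K * P :=
      le_trans (by positivity) (hK (s.1 + 1) (by omega) (by omega))
    exact QCTSP.exists_levels (by positivity)
  choose N hN hN' using hlev
  refine ⟨fun s => QCTSP.rotationCircuit n lτ w wt P s,
    QCTSP.estimation (QCTSP.Wire n lx lτ w) QCTSP.posTerm N (QCTSP.coeff f a hP 0).re
      fun s => QCTSP.termWeight f a hP (s.1 + 1) (QCTSP.posTerm s).part,
    fun s => QCTSP.isRotationCircuit_rotationCircuit wt P s, ?_⟩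
  intro Ω _ μ _ X R prep hprep
  have hn1 : (1 : ℝ) ≤ n := by exact_mod_cast hn
  have hlx1 : (1 : ℝ) ≤ lx := by exact_mod_cast hlx
  have hlτ1 : (1 : ℝ) ≤ lτ := by exact_mod_cast hlτ
  have hnl : (1 : ℝ) ≤ n * lx * lτ := by
    exact_mod_cast Nat.mul_pos (Nat.mul_pos hn hlx) hlτ
  have hdepth : ∀ s : QCTSP.Term L,
      ((QCTSP.evalCircuit prep (QCTSP.rotationCircuit n lτ w wt P s)).depth : ℝ) =
        prep.depth + n * lx * lτ + 1 := by
    intro s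
    rw [QCTSP.depth_evalCircuit]
    push_cast
    ring
  have hprep0 : (0 : ℝ) ≤ prep.depth := Nat.cast_nonneg _
  have hmean : ∫ ω, QCTSP.fourierApprox f a hP L (R.pathIntegral ω) ∂μ =
      (QCTSP.coeff f a hP 0).re + ∑ s : Fin L × Bool,
        QCTSP.termWeight f a hP (s.1 + 1) (QCTSP.posTerm s).part *
        (2 * QCTSP.targetProb (QCTSP.evalCircuit prep
          (QCTSP.rotationCircuit n lτ w wt P (QCTSP.posTerm s))) - 1) := by
    rw [QCTSP.integral_fourierApprox]
    congr 1
    refine Finset.sum_congr rfl fun s _ => ?_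
    rw [QCTSP.targetProb_evalCircuit R hprep]
    congr 1
    ring
  refine ⟨R.ae_pathIntegral, fun s => ⟨?_, QCTSP.targetProb_evalCircuit R hprep P s⟩, ?_, ?_⟩
  · rw [hdepth]
    nlinarith
  · have hD : ∀ s : QCTSP.Term L,
        ((QCTSP.evalCircuit prep (QCTSP.rotationCircuit n lτ w wt P s)).depth +
          6 * Fintype.card (QCTSP.Wire n lx lτ w ⊕ Unit) + 10 : ℝ) ≤
          42 * (prep.depth + n * lx * lτ) := by
      intro s
      have hcard : (Fintype.card (QCTSP.Wire n lx lτ w ⊕ Unit) : ℝ) =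
          n * lx + n * lτ + w + 1 := by
        simp only [Fintype.card_sum, Fintype.card_prod, Fintype.card_fin, Fintype.card_unit]
        push_cast
        ring
      have hw' : (w : ℝ) ≤ n * (lx + lτ) := by exact_mod_cast hw
      -- With `w ≤ n(lx + lτ)`, there are at most `4 n lx lτ + 1` qubits, so the overhead is covered
      -- by `1 + 17 + 24 = 42` times `n lx lτ`.
      have hmul : (lx : ℝ) + lτ ≤ 2 * (lx * lτ) := by nlinarith
      have hmul' : (n : ℝ) * (lx + lτ) ≤ n * (2 * (lx * lτ)) :=
        mul_le_mul_of_nonneg_left hmul (by positivity)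
      rw [hdepth, hcard]
      nlinarith
    refine (QCTSP.time_estimation_le _ _ _ _ _ hD).trans ?_
    rcases Nat.eq_zero_or_pos L with rfl | hL
    · simp
    have hKP : 0 ≤ K * P := le_trans (by positivity) (hK 1 le_rfl hL)
    have hsum : ∑ s, ((3 : ℝ) ^ N s - 2 ^ N s) ≤ 288 * E * (K * P * L) / ε := by
      refine (Finset.sum_le_sum fun s _ => hN' s).trans ?_
      have h1 := QCTSP.sum_fin_prod_bool (L := L) fun l _ =>
        3 * (24 * E * (K * P * √L) / ε / √(l : ℝ))
      rw [h1]
      have h2 : ∀ l ∈ Finset.range L, 3 * (24 * E * (K * P * √L) / ε / √((l + 1 : ℕ) : ℝ)) +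
          3 * (24 * E * (K * P * √L) / ε / √((l + 1 : ℕ) : ℝ)) =
          6 * (24 * E * (K * P * √L) / ε) * (1 / √((l + 1 : ℕ) : ℝ)) := fun l _ => by ring
      rw [Finset.sum_congr rfl h2, ← Finset.mul_sum]
      refine (mul_le_mul_of_nonneg_left (QCTSP.sum_one_div_sqrt_le L) (by positivity)).trans ?_
      have h3 : √(L : ℝ) * √L = L := Real.mul_self_sqrt (by positivity)
      refine le_of_eq ?_
      calc _ = 288 * E * (K * P * (√(L : ℝ) * √L)) / ε := by ring
        _ = _ := by rw [h3]
    refine (mul_le_mul_of_nonneg_left hsum (by positivity)).trans (le_of_eq ?_)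
    ring
  -- Each term is at most `ε/(12 √L √l)`. The two parts and `∑ 1/√l ≤ 2√L` give `ε/3`.
  have herr : ∑ s : Fin L × Bool, |QCTSP.termWeight f a hP (s.1 + 1) (QCTSP.posTerm s).part| *
      (E * (1 / 3) ^ N s) ≤ ε / 3 := by
    have hs : ∀ s : Fin L × Bool,
        |QCTSP.termWeight f a hP (s.1 + 1) (QCTSP.posTerm s).part| * (E * (1 / 3) ^ N s) ≤
          ε / (12 * √L) * (1 / √((s.1 + 1 : ℕ) : ℝ)) := by
      intro s
      have hL : 0 < L := by have := s.1.2; omega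
      have hq : 0 < √(L : ℝ) := Real.sqrt_pos.2 (by exact_mod_cast hL)
      have hr : 0 < √((s.1 + 1 : ℕ) : ℝ) := Real.sqrt_pos.2 (by positivity)
      have hr2 : √((s.1 + 1 : ℕ) : ℝ) * √((s.1 + 1 : ℕ) : ℝ) = (s.1 + 1 : ℕ) :=
        Real.mul_self_sqrt (by positivity)
      have hT : (0 : ℝ) < 3 ^ N s := by positivity
      have hγ := QCTSP.abs_termWeight_le f a hP (s.1 + 1) (QCTSP.posTerm s).part
      have hc := hK (s.1 + 1) (by omega) (by omega)
      have hNs := hN s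
      rw [div_div, div_le_iff₀ (by positivity)] at hNs
      rw [← hr2] at hc
      set q := √(L : ℝ)
      set r := √((s.1 + 1 : ℕ) : ℝ)
      set g := |QCTSP.termWeight f a hP (s.1 + 1) (QCTSP.posTerm s).part|
      set T : ℝ := 3 ^ N s with hTdef
      have hg : g * (r * r) ≤ 2 * (K * P) := by nlinarith [mul_pos hr hr]
      rw [one_div_pow, ← hTdef, show g * (E * (1 / T)) = g * E / T by ring,
        show ε / (12 * q) * (1 / r) = ε / (12 * q * r) by field_simp,
        div_le_div_iff₀ hT (by positivity)]
      refine le_of_mul_le_mul_right ?_ hr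
      calc g * E * (12 * q * r) * r = 12 * E * q * (g * (r * r)) := by ring
        _ ≤ 12 * E * q * (2 * (K * P)) := mul_le_mul_of_nonneg_left hg (by positivity)
        _ = 24 * E * (K * P * q) := by ring
        _ ≤ ε * T * r := by linarith
    refine (Finset.sum_le_sum fun s _ => hs s).trans ?_
    have h1 := QCTSP.sum_fin_prod_bool (L := L) fun l _ => ε / (12 * √L) * (1 / √(l : ℝ))
    rw [h1, Finset.sum_congr rfl fun l _ =>
      (two_mul (ε / (12 * √(L : ℝ)) * (1 / √((l + 1 : ℕ) : ℝ)))).symm, ← Finset.mul_sum,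
      ← Finset.mul_sum]
    rcases Nat.eq_zero_or_pos L with rfl | hL
    · simpa using (div_pos hε three_pos).le
    · have hq : 0 < √(L : ℝ) := Real.sqrt_pos.2 (by exact_mod_cast hL)
      calc _ ≤ 2 * (ε / (12 * √(L : ℝ)) * (2 * √L)) := by
            gcongr
            exact QCTSP.sum_one_div_sqrt_le L
        _ = ε / 3 := by field_simp; norm_num
  have hmain : 2 / 3 ≤ (QCTSP.estimation (QCTSP.Wire n lx lτ w) QCTSP.posTerm N
      (QCTSP.coeff f a hP 0).re fun s => QCTSP.termWeight f a hP (s.1 + 1)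
        (QCTSP.posTerm s).part).probWithin
      (fun s => QCTSP.evalCircuit prep (QCTSP.rotationCircuit n lτ w wt P s))
      (∫ ω, QCTSP.fourierApprox f a hP L (R.pathIntegral ω) ∂μ) ε := by
    have h1 := QCTSP.expect_estimation_le QCTSP.posTerm N (QCTSP.coeff f a hP 0).re
      (fun s => QCTSP.termWeight f a hP (s.1 + 1) (QCTSP.posTerm s).part)
      (fun s => QCTSP.evalCircuit prep (QCTSP.rotationCircuit n lτ w wt P s))
    rw [← hmean] at h1
    refine le_trans ?_ (QCTSP.one_sub_le_probWithin _ _ hε)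
    have h2 := div_le_div_of_nonneg_right (h1.trans herr) hε.le
    rw [div_right_comm, div_self hε.ne'] at h2
    linarith
  refine ⟨hmain, hmain.trans (QCTSP.probWithin_mono _ _ ?_)⟩
  -- The bias between the two expectations is at most the mean absolute truncation error.
  rw [abs_sub_comm, ← MeasureTheory.integral_sub (R.integrable_comp_pathIntegral f)
    (R.integrable_comp_pathIntegral _)]
  gcongr
  exact MeasureTheory.abs_integral_le_integral_abs
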